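/- \textbf{Setting.} An input/output structural causal model (ioSCM) has a finite set $V$ of non-latent variables, split into input variables $J$ and observed variables $O$, and finitely many independent latent variables $L$. Its directed graph on $V\cup L$ has no edge from a variable to itself and no edge into $J\cup L$, and every observed variable is a child of some variable in $L\cup J$. A \emph{loop} is a nonempty vertex set $S$ such that any two of its vertices are joined by directed paths inside $S$; a \emph{cycle} is a loop with at least two vertices. For every loop $S\subseteq O$ there is a measurable function $f^S$ from values of $\mathrm{Pa}(S)\setminus S$ to values of $S$, and these are compatible: if $S'\subsetneq S$ are loops in $O$ and an assignment $v$ satisfies $f^S(v_{\mathrm{Pa}(S)\setminus S})=v_S$, then $f^{S'}(v_{\mathrm{Pa}(S')\setminus S'})=v_{S'}$. Given values of the inputs and of the latent variables, there is exactly one assignment of $O$ that satisfies the equations of all loops in $O$; this defines the distribution of the model. The intervention $\mathrm{do}(X)$ turns the variables of $X$ into inputs, deletes the edges into $X$, and keeps $f^S$ for the loops $S$ that avoid $X$. The induced directed mixed graph (DMG) on $V$ keeps the directed edges between variables of $V$ and has $A\leftrightarrow B$ for distinct $A,B$ with a common latent parent. A \emph{C-DMG} is a graph $G^c$ on a partition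 $\mathbb C$ of $V$ into nonempty clusters for which there is a compatible DMG, that is, a DMG $G$ induced by an ioSCM such that $C\to D$ (resp. $C\leftrightarrow D$, where $C=D$ is allowed) is in $G^c$ if and only if $A\to B$ (resp. $A\leftrightarrow B$) is in $G$ for some $A\in C$, $B\in D$. For disjoint $C_X,C_Y\subseteq\mathbb C$, the macro effect $P(c_y\mid \mathrm{do}(c_x))$ is \emph{identifiable} in $G^c$ if any two ioSCMs without input variables, with the same finite domains of the variables in $V$, whose DMGs are compatible with $G^c$ and which have the same positive observational distribution $P(v)$, have the same $P(c_y\mid\mathrm{do}(c_x))$ for all values $c_x$, $c_y$. The \emph{SC-projection} $H^c$ of $G^c$ is $G^c$ with an added bidirected edge between any two distinct clusters with the same strongly connected component. A \emph{C-forest} is a graph without directed cycles (self-loops included) in which every vertex has at most one child and any two vertices are joined by a path of bidirected edges; its roots are the vertices without children. An \emph{SC-hedge} for $(C_X,C_Y)$ in $G^c$ is a pair of subgraphs $F'\subseteq F$ of $H^c$ that are C-forests with the same set of roots $R$, such that $F$ contains a vertex of $C_X$, $F'$ contains none, and every vertex of $R$ is an ancestor of (or equal to) a vertex of $C_Y$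 in $H^c\setminus C_X$. \textbf{Theorem.} Let $G^c$ be a C-DMG on $\mathbb C$ in which every cluster that lies in a cycle has at least $2$ variables, and let $C_X,C_Y\subseteq\mathbb C$ be disjoint. If there is an SC-hedge for $(C_X,C_Y)$ in $G^c$, then $P(c_y\mid\mathrm{do}(c_x))$ is not identifiable in $G^c$. -/

import Mathlib

open MeasureTheory Relation

universe u

/-- A mixed graph: directed edges `dir u v` (`u → v`) and bidirected edges `bi u v` (`u ↔ v`).
Edges from a vertex to itself are allowed. -/
structure MixedGraph (N : Type u) where
  dir : N → N → Prop
  bi : N → N → Prop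
  bi_symm : ∀ a b, bi a b → bi b a

/-- A loop of the directed graph `dir`: a nonempty set of vertices any two of which are joined by
directed paths (in both directions) inside the subgraph induced on the set. -/
def IsLoop {N : Type u} (dir : N → N → Prop) (S : Set N) : Prop :=
  S.Nonempty ∧
    ∀ a ∈ S, ∀ b ∈ S, ReflTransGen (fun p q => p ∈ S ∧ q ∈ S ∧ dir p q) a b

namespace MixedGraph

variable {N : Type u}

/-- A cycle is a loop that is not a singleton. -/
def IsCycle (G : MixedGraph N) (S : Set N) : Prop :=
  IsLoop G.dir S ∧ S.Nontrivial

/-- Ancestors of a set of vertices; every vertex is its own ancestor. -/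
def ancestors (G : MixedGraph N) (B : Set N) : Set N :=
  {a | ∃ b ∈ B, ReflTransGen G.dir a b}

/-- Descendants of a set of vertices; every vertex is its own descendant. -/
def descendants (G : MixedGraph N) (A : Set N) : Set N :=
  {b | ∃ a ∈ A, ReflTransGen G.dir a b}

/-- The strongly connected component of a vertex. -/
def scc (G : MixedGraph N) (a : N) : Set N :=
  G.ancestors {a} ∩ G.descendants {a}

/-- `G \ X`: the graph obtained by deleting the vertices in `X` (they stay in the vertex type, as
isolated vertices). -/
def deleteVerts (G : MixedGraph N) (X : Set N) : MixedGraph N where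
  dir a b := a ∉ X ∧ b ∉ X ∧ G.dir a b
  bi a b := a ∉ X ∧ b ∉ X ∧ G.bi a b
  bi_symm a b h := ⟨h.2.1, h.1, G.bi_symm a b h.2.2⟩

/-- The SC-projection: add a bidirected edge between any two distinct vertices that have the same
strongly connected component. -/
def scProjection (G : MixedGraph N) : MixedGraph N where
  dir := G.dir
  bi a b := G.bi a b ∨ (a ≠ b ∧ G.scc a = G.scc b)
  bi_symm a b h := h.imp (G.bi_symm a b) fun h => ⟨h.1.symm, h.2.symm⟩

/-- A subgraph, with its own set of vertices and its own sets of edges. -/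
structure Sub (G : MixedGraph N) where
  verts : Set N
  dir : N → N → Prop
  bi : N → N → Prop
  bi_symm : ∀ a b, bi a b → bi b a
  dir_sub : ∀ a b, dir a b → a ∈ verts ∧ b ∈ verts ∧ G.dir a b
  bi_sub : ∀ a b, bi a b → a ∈ verts ∧ b ∈ verts ∧ G.bi a b

namespace Sub

variable {G : MixedGraph N}

/-- The roots: the vertices without children. -/
def roots (F : G.Sub) : Set N :=
  {a | a ∈ F.verts ∧ ∀ b, ¬ F.dir a b}

/-- C-forest: acyclic, every vertex has at most one child, and any two vertices are joined by a
path of bidirected edges. -/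
def IsCForest (F : G.Sub) : Prop :=
  (∀ a, ¬ TransGen F.dir a a) ∧
  (∀ a b c, F.dir a b → F.dir a c → b = c) ∧
  ∀ a ∈ F.verts, ∀ b ∈ F.verts, ReflTransGen F.bi a b

/-- `F'` is a subgraph of `F`. -/
def IsSubOf (F' F : G.Sub) : Prop :=
  F'.verts ⊆ F.verts ∧ (∀ a b, F'.dir a b → F.dir a b) ∧ ∀ a b, F'.bi a b → F.bi a b

end Sub

/-- The subgraphs `F` and `F'` of `G` form a hedge for `(X, Y)`: they are C-forests with the same
set of roots `R`, `F` meets `X`, `F'` does not, `F' ⊆ F`, and `R ⊆ An(Y)` in `G \ X`. -/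
def IsHedge (G : MixedGraph N) (X Y : Set N) (F F' : G.Sub) : Prop :=
  F.IsCForest ∧ F'.IsCForest ∧
  ∃ R : Set N, F.roots = R ∧ F'.roots = R ∧
    (X ∩ F.verts).Nonempty ∧ X ∩ F'.verts = ∅ ∧ F'.IsSubOf F ∧
    R ⊆ (G.deleteVerts X).ancestors Y

/-- There is an SC-hedge for `(X, Y)` in `G`: a hedge for `(X, Y)` in the SC-projection of `G`. -/
def HasSCHedge (G : MixedGraph N) (X Y : Set N) : Prop :=
  ∃ F F' : G.scProjection.Sub, G.scProjection.IsHedge X Y F F'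

/-- `G` is the cluster graph of `D` for the clusters `cl ⁻¹' {c}`, that is, `D` is compatible with
`G`. -/
def IsClusterGraph {V : Type*} (G : MixedGraph N) (cl : V → N) (D : MixedGraph V) : Prop :=
  (∀ c d, G.dir c d ↔ ∃ a b, cl a = c ∧ cl b = d ∧ D.dir a b) ∧
  ∀ c d, G.bi c d ↔ ∃ a b, cl a = c ∧ cl b = d ∧ D.bi a b

end MixedGraph

/-- An input/output structural causal model with non-latent variables `V`; the variable `v` takes
its values in `Ω v`. The variables in `input` are the input variables, the others are the observed
variables. The vertices of the underlying graph are `V` and the latent variables `Lat`, its edges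
are given by `dir` and `lat`. The latent variables are independent. -/
structure IOSCM (V : Type u) (Ω : V → Type) [∀ v, MeasurableSpace (Ω v)] where
  /-- the input variables -/
  input : Set V
  /-- the latent variables -/
  Lat : Type
  [latFintype : Fintype Lat]
  /-- the domains of the latent variables -/
  Val : Lat → Type
  [valMeasurableSpace : ∀ l, MeasurableSpace (Val l)]
  /-- the edges between non-latent variables -/
  dir : V → V → Prop
  /-- the edges from latent to non-latent variables -/
  lat : Lat → V → Prop
  dir_irrefl : ∀ v, ¬ dir v v
  dir_not_input : ∀ a v, dir a v → v ∉ input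
  lat_not_input : ∀ l v, lat l v → v ∉ input
  /-- every observed variable is a child of a latent or of an input variable -/
  observed_child : ∀ v, v ∉ input → (∃ l, lat l v) ∨ ∃ a ∈ input, dir a v
  /-- the function `f^S` of a loop `S` of observed variables: it maps values of `Pa(S) \ S` to
  values of `S` -/
  mech : ∀ S : Set V, S ⊆ inputᶜ → IsLoop dir S →
    (∀ a : {a // a ∉ S ∧ ∃ v ∈ S, dir a v}, Ω a) → (∀ l : {l // ∃ v ∈ S, lat l v}, Val l) →
      ∀ v : S, Ω v
  mech_measurable : ∀ S hS hl, Measurable fun p :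
    (∀ a : {a // a ∉ S ∧ ∃ v ∈ S, dir a v}, Ω a) × (∀ l : {l // ∃ v ∈ S, lat l v}, Val l) =>
      mech S hS hl p.1 p.2
  /-- global compatibility of the mechanisms -/
  mech_compat : ∀ (S' S : Set V) hS' hl' hS hl, S' ⊂ S → ∀ (z : ∀ v, Ω v) (e : ∀ l, Val l),
    (∀ v : S, mech S hS hl (fun a => z a.1) (fun l => e l.1) v = z v.1) →
      ∀ v : S', mech S' hS' hl' (fun a => z a.1) (fun l => e l.1) v = z v.1
  /-- the distributions of the latent variables -/
  law : ∀ l, Measure (Val l)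
  [law_prob : ∀ l, IsProbabilityMeasure (law l)]

namespace IOSCM

attribute [instance] IOSCM.latFintype IOSCM.valMeasurableSpace IOSCM.law_prob

variable {V : Type u} {Ω : V → Type} [∀ v, MeasurableSpace (Ω v)]

/-- The directed mixed graph induced by the model: two distinct variables are joined by a
bidirected edge when they have a common latent parent. -/
def dmg (M : IOSCM V Ω) : MixedGraph V where
  dir := M.dir
  bi a b := a ≠ b ∧ ∃ l, M.lat l a ∧ M.lat l b
  bi_symm _ _ h := ⟨h.1.symm, h.2.imp fun _ h => ⟨h.2, h.1⟩⟩

/-- The joint distribution of the latent variables. -/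
noncomputable def latentLaw (M : IOSCM V Ω) : Measure (∀ l, M.Val l) :=
  Measure.pi M.law

/-- `z` solves the model when the input variables are set to their values in `x` and the latent
variables have the values `e`. -/
def IsSolution (M : IOSCM V Ω) (x : ∀ v, Ω v) (e : ∀ l, M.Val l) (z : ∀ v, Ω v) : Prop :=
  (∀ v ∈ M.input, z v = x v) ∧
  ∀ (S : Set V) hS hl, ∀ v : S, M.mech S hS hl (fun a => z a.1) (fun l => e l.1) v = z v.1

/-- The probability that the solution of the model lies in `A` when the input variables are set to
their values in `x`. -/
noncomputable def prob (M : IOSCM V Ω) (x : ∀ v, Ω v) (A : Set (∀ v, Ω v)) : ENNReal :=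
  M.latentLaw {e | ∃ z, M.IsSolution x e z ∧ z ∈ A}

/-- If there are finitely many variables, then the solution exists and is unique. -/
theorem existsUnique_isSolution [Finite V] (M : IOSCM V Ω) (x : ∀ v, Ω v) (e : ∀ l, M.Val l) :
    ∃! z, M.IsSolution x e z := by
  classical
  -- strongly connected components among the observed variables
  let r : V → V → Prop := fun p q => p ∉ M.input ∧ q ∉ M.input ∧ M.dir p q
  let K : V → Set V := fun v => {a | ReflTransGen r a v ∧ ReflTransGen r v a}
  have hKself : ∀ v, v ∈ K v := fun v => ⟨.refl, .refl⟩
  have hKeq : ∀ v a, a ∈ K v → K a = K v := by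
    intro v a h
    ext b
    exact ⟨fun hb => ⟨hb.1.trans h.1, h.2.trans hb.2⟩,
      fun hb => ⟨hb.1.trans h.2, h.1.trans hb.2⟩⟩
  have hobs : ∀ a b, ReflTransGen r a b → b ∉ M.input → a ∉ M.input := by
    intro a b h hb
    rcases ReflTransGen.cases_head h with h | ⟨c, h, -⟩
    · exact h ▸ hb
    · exact h.1
  have hKobs : ∀ v, v ∉ M.input → K v ⊆ M.inputᶜ := fun v hv a ha => hobs a v ha.1 hv
  have hKloop : ∀ v, v ∉ M.input → IsLoop M.dir (K v) := by
    intro v hv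
    refine ⟨⟨v, hKself v⟩, fun a ha b hb => ?_⟩
    have hab : ReflTransGen r a b := ha.1.trans hb.2
    have key : ∀ c, ReflTransGen r c b → ReflTransGen r a c →
        ReflTransGen (fun p q => p ∈ K v ∧ q ∈ K v ∧ M.dir p q) c b := by
      intro c hcb
      induction hcb using ReflTransGen.head_induction_on with
      | refl => exact fun _ => .refl
      | head h1 h2 ih =>
        intro hac
        refine .head ⟨⟨(ReflTransGen.head h1 h2).trans hb.1, ha.2.trans hac⟩,
          ⟨h2.trans hb.1, ha.2.trans (hac.tail h1)⟩, h1.2.2⟩ (ih (hac.tail h1))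
    exact key a hab .refl
  -- every loop of observed variables lies in a component
  have hsub : ∀ S, S ⊆ M.inputᶜ → IsLoop M.dir S → ∀ v ∈ S, S ⊆ K v := by
    intro S hS hl v hv a ha
    have mono : ∀ p q, (p ∈ S ∧ q ∈ S ∧ M.dir p q) → r p q :=
      fun p q h => ⟨hS h.1, hS h.2.1, h.2.2⟩
    exact ⟨(hl.2 a ha v hv).lift id mono, (hl.2 v hv a ha).lift id mono⟩
  -- the strict order on observed variables
  let lt : V → V → Prop := fun a v => ReflTransGen r a v ∧ ¬ ReflTransGen r v a
  have hwf : WellFounded lt := by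
    have : IsTrans V lt := ⟨fun a b c h1 h2 =>
      ⟨h1.1.trans h2.1, fun h => h1.2 (h2.1.trans h)⟩⟩
    have : Std.Irrefl lt := ⟨fun a h => h.2 h.1⟩
    exact Finite.wellFounded_of_trans_of_irrefl lt
  have hpar : ∀ v, v ∉ M.input → ∀ a, a ∉ K v → (∃ w ∈ K v, M.dir a w) →
      a ∉ M.input → lt a v := by
    rintro v hv a ha ⟨w, hw, haw⟩ hai
    have h1 : ReflTransGen r a v := .head ⟨hai, hKobs v hv hw, haw⟩ hw.1
    exact ⟨h1, fun h => ha ⟨h1, h⟩⟩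
  -- a solution is determined by the equations of the components
  have hred : ∀ z, M.IsSolution x e z ↔ (∀ v ∈ M.input, z v = x v) ∧
      ∀ v (hv : v ∉ M.input),
        M.mech (K v) (hKobs v hv) (hKloop v hv) (fun a => z a.1) (fun l => e l.1) ⟨v, hKself v⟩
          = z v := by
    intro z
    refine ⟨fun h => ⟨h.1, fun v hv => h.2 _ _ _ ⟨v, hKself v⟩⟩, fun h => ⟨h.1, ?_⟩⟩
    intro S hS hl
    obtain ⟨v, hv⟩ := hl.1
    have hvo : v ∉ M.input := hS hv
    have hfull : ∀ w : K v,
        M.mech (K v) (hKobs v hvo) (hKloop v hvo) (fun a => z a.1) (fun l => e l.1) w = z w := by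
      rintro ⟨w, hw⟩
      have hwo := hKobs v hvo hw
      have h2 := h.2 w hwo
      have gen : ∀ (T : Set V) (hT : T ⊆ M.inputᶜ) (hTl : IsLoop M.dir T) (hwT : w ∈ T),
          T = K w → M.mech T hT hTl (fun a => z a.1) (fun l => e l.1) ⟨w, hwT⟩ = z w := by
        rintro T hT hTl hwT rfl
        exact h2
      exact gen (K v) _ _ hw (hKeq v w hw).symm
    rcases (hsub S hS hl v hv).eq_or_ssubset with h3 | h3
    · subst h3
      exact hfull
    · exact M.mech_compat S (K v) hS hl (hKobs v hvo) (hKloop v hvo) h3 z e hfull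
  let F : ∀ v, (∀ a, lt a v → Ω a) → Ω v := fun v rec =>
    if hv : v ∈ M.input then x v else
      M.mech (K v) (hKobs v hv) (hKloop v hv)
        (fun a => if h : lt a v then rec a h else x a) (fun l => e l.1) ⟨v, hKself v⟩
  have hF : ∀ z : ∀ v, Ω v, M.IsSolution x e z ↔ ∀ v, z v = F v fun a _ => z a := by
    intro z
    rw [hred]
    have hin : (∀ v ∈ M.input, z v = x v) → ∀ v (hv : v ∉ M.input),
        (F v fun a _ => z a) =
          M.mech (K v) (hKobs v hv) (hKloop v hv) (fun a => z a.1) (fun l => e l.1) ⟨v, hKself v⟩ := by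
      intro h1 v hv
      simp only [F, dif_neg hv]
      congr 1
      funext a
      split_ifs with h
      · rfl
      · by_cases ha : a.1 ∈ M.input
        · exact (h1 _ ha).symm
        · exact absurd (hpar v hv a.1 a.2.1 a.2.2 ha) h
    constructor
    · rintro ⟨h1, h2⟩ v
      by_cases hv : v ∈ M.input
      · simp only [F, dif_pos hv]
        exact h1 v hv
      · rw [hin h1 v hv, h2 v hv]
    · intro h
      have h1 : ∀ v ∈ M.input, z v = x v := by
        intro v hv
        rw [h v]
        simp only [F, dif_pos hv]
      exact ⟨h1, fun v hv => by rw [← hin h1 v hv, ← h v]⟩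
  refine ⟨fun v => hwf.fix F v, (hF _).2 fun v => hwf.fix_eq F v, ?_⟩
  intro z hz
  have hz := (hF z).1 hz
  funext v
  induction v using hwf.induction with
  | _ v ih =>
    rw [hz v, hwf.fix_eq]
    exact congrArg (F v) (funext fun a => funext fun h => ih a h)

/-- The model obtained by the intervention on the variables in `X`: these become input variables,
the edges into them are removed, and the mechanisms of the other loops are kept. -/
def intervene (M : IOSCM V Ω) (X : Set V) : IOSCM V Ω where
  input := M.input ∪ X
  Lat := M.Lat
  Val := M.Val
  dir a v := M.dir a v ∧ v ∉ X
  lat l v := M.lat l v ∧ v ∉ X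
  dir_irrefl v h := M.dir_irrefl v h.1
  dir_not_input a v h hv := hv.elim (M.dir_not_input a v h.1) h.2
  lat_not_input l v h hv := hv.elim (M.lat_not_input l v h.1) h.2
  observed_child v hv :=
    (M.observed_child v fun h => hv (.inl h)).imp
      (fun ⟨l, h⟩ => ⟨l, h, fun h => hv (.inr h)⟩)
      (fun ⟨a, ha, h⟩ => ⟨a, .inl ha, h, fun h => hv (.inr h)⟩)
  mech S hS hl p q :=
    M.mech S (fun _ hv h => hS hv (.inl h))
      ⟨hl.1, fun a ha b hb => (hl.2 a ha b hb).lift id fun _ _ h => ⟨h.1, h.2.1, h.2.2.1⟩⟩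
      (fun a => p ⟨a.1, a.2.1, a.2.2.imp fun _ h => ⟨h.1, h.2, fun hx => hS h.1 (.inr hx)⟩⟩)
      (fun l => q ⟨l.1, l.2.imp fun _ h => ⟨h.1, h.2, fun hx => hS h.1 (.inr hx)⟩⟩)
  mech_measurable S hS hl := by
    refine (M.mech_measurable S _ _).comp (Measurable.prodMk ?_ ?_)
    · exact measurable_pi_lambda _ fun _ => (measurable_pi_apply _).comp measurable_fst
    · exact measurable_pi_lambda _ fun _ => (measurable_pi_apply _).comp measurable_snd
  mech_compat S' S hS' hl' hS hl h z e := M.mech_compat S' S _ _ _ _ h z e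
  law := M.law

/-- `P(A | do(X = x))`; only the values of `x` on `X` and on the input variables matter. -/
noncomputable def doProb (M : IOSCM V Ω) (X : Set V) (x : ∀ v, Ω v) (A : Set (∀ v, Ω v)) :
    ENNReal :=
  (M.intervene X).prob x A

end IOSCM

namespace MixedGraph

variable {V C : Type*}

/-- `G` is a C-DMG over DMGs on the partition of the variables `V` into the clusters
`cl ⁻¹' {c}`: it is the cluster graph of the DMG induced by some ioSCM. -/
def IsCDMG (G : MixedGraph C) (cl : V → C) : Prop :=
  Function.Surjective cl ∧
  ∃ (Ω : V → Type) (_ : ∀ v, MeasurableSpace (Ω v)) (M : IOSCM V Ω), G.IsClusterGraph cl M.dmg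

/-- The macro causal effect of the set of clusters `X` on the set of clusters `Y` is identifiable
in the C-DMG `G`: any two ioSCMs (without input variables, with the same finite domains of the
variables) that are compatible with `G` and have the same positive observational distribution
`P(v)` have the same `P(c_y | do(c_x))`, for all values `c_x` of `X` and `c_y` of `Y`.
In the events, `x` and `y` are used only at the variables in the clusters of `X` and of `Y`; the
observational probabilities do not depend on `x`. -/
def MacroIdentifiable (G : MixedGraph C) (cl : V → C) (X Y : Set C) : Prop :=
  ∀ (Ω : V → Type) [∀ v, Finite (Ω v)] [∀ v, MeasurableSpace (Ω v)]
    [∀ v, DiscreteMeasurableSpace (Ω v)] (M₁ M₂ : IOSCM V Ω),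
    M₁.input = ∅ → M₂.input = ∅ →
    G.IsClusterGraph cl M₁.dmg → G.IsClusterGraph cl M₂.dmg →
    (∀ x v, 0 < M₁.prob x {v}) → (∀ x v, M₁.prob x {v} = M₂.prob x {v}) →
    ∀ x y : ∀ v, Ω v,
      M₁.doProb (cl ⁻¹' X) x {v | ∀ a, cl a ∈ Y → v a = y a} =
        M₂.doProb (cl ⁻¹' X) x {v | ∀ a, cl a ∈ Y → v a = y a}

end MixedGraph

/-! In the largest DMG compatible with `G`, one representative variable per cluster turns the
SC-hedge into an SC-hedge between variables (`HasSCHedge.expand`). From its two forests come two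
models that agree observationally and differ under the intervention.

Each forest vertex carries a bit, the sum modulo 2 of its parents' bits and of coins on its
bidirected edges. The ends of a genuine bidirected edge read one common latent coin, so in the sum
over the forest it cancels. An edge added by the SC-projection has no common latent variable; its
ends have independent coins, and a closed walk through both carries a ring of coordinates, each
copying its predecessor except at one random value. Such a cyclic system can have many solutions.
The mechanism of a set containing the whole ring sees both coins and selects a solution whose parity
at the target is their sum; the target adds this parity, and the coins cancel again. A smaller set
only enforces the copying equations, which the selected solution satisfies (`hop_sel`), so the
mechanisms are compatible. Transport coordinates carry the root bits to `Y`, and biased noise on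
them and on one root bit makes the distribution positive.

Observationally, the noise is a function of the observed bits (`obsNoise_eq`), and given the rings
and the noise the bits are uniform, because flipping both coins of an edge is invisible to rings and
noise. Hence the distribution does not depend on the forest (`ncard_fiber_wiring`). Under the
intervention the smaller forest is intact: the sum of the transported bits at `Y` equals the total
noise, which is biased (`two_mul_ncard_rootSum_ne`). The larger forest is cut, and some edge joins a
bit whose path to `Y` survives to one whose path is broken; flipping its coins flips the sum, which
is therefore uniform (`two_mul_ncard_rootSum_eq`).

The rings of the smaller forest must also avoid `X`. If one component it uses meets `X`, then an
edge leaving `X` inside this component is itself an SC-hedge that needs no ring in its smaller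
forest (`exists_safe_hedge`). -/

/-! ### Systems of equations and the ioSCMs that they define -/

/-- A system of structural equations on the variables `V`, driven by uniform latent variables with
values in `W`. The relation `Sat S e y` says that `y` satisfies the equations of the variables in
`S`, including the choice of a solution for the loops inside `S`, when the latent variables have
the values `e`. -/
structure EqSystem (V : Type u) (Ω : V → Type) where
  /-- the latent variables -/
  Lat : Type
  [latFintype : Fintype Lat]
  /-- the domain of the latent variables -/
  W : Type
  [wFintype : Fintype W]
  [wNonempty : Nonempty W]
  /-- the edges between variables -/
  dir : V → V → Prop
  /-- the edges from latent variables to variables -/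
  lat : Lat → V → Prop
  dir_irrefl : ∀ v, ¬ dir v v
  exists_lat : ∀ v, ∃ l, lat l v
  /-- satisfaction of the equations of a set of variables -/
  Sat : Set V → (Lat → W) → (∀ v, Ω v) → Prop
  existsUnique_sat : ∀ S e (z : ∀ v, Ω v), ∃! y : ∀ v, Ω v, (∀ v, v ∉ S → y v = z v) ∧ Sat S e y
  sat_mono : ∀ S' S e y, S' ⊆ S → Sat S e y → Sat S' e y
  sat_local : ∀ S e e' (y y' : ∀ v, Ω v), (∀ v, (v ∈ S ∨ ∃ w ∈ S, dir v w) → y v = y' v) →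
    (∀ l, (∃ v ∈ S, lat l v) → e l = e' l) → Sat S e y → Sat S e' y'

namespace EqSystem

attribute [instance] EqSystem.latFintype EqSystem.wFintype EqSystem.wNonempty

variable {V : Type u} {Ω : V → Type}

open scoped Classical in
/-- Extend the values on a subset of the variables to all variables. -/
noncomputable def fill {ι : Type*} {α : ι → Type*} [∀ v, Nonempty (α v)] (P : ι → Prop)
    (p : ∀ a : {a // P a}, α a) (a : ι) : α a :=
  if h : P a then p ⟨a, h⟩ else Classical.arbitrary _

theorem fill_of {ι : Type*} {α : ι → Type*} [∀ v, Nonempty (α v)] {P : ι → Prop}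
    (p : ∀ a : {a // P a}, α a) {a : ι} (h : P a) : fill P p a = p ⟨a, h⟩ :=
  dif_pos h

variable (M : EqSystem V Ω)

/-- The probability of a single value of the latent variables. -/
noncomputable def weight : ENNReal := ((Fintype.card M.W : ENNReal)⁻¹) ^ Fintype.card M.Lat

theorem weight_ne_zero : M.weight ≠ 0 :=
  pow_ne_zero _ (ENNReal.inv_ne_zero.2 (ENNReal.natCast_ne_top _))

theorem weight_ne_top : M.weight ≠ ⊤ :=
  ENNReal.pow_ne_top (ENNReal.inv_ne_top.2 (Nat.cast_ne_zero.2 Fintype.card_ne_zero))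

variable [∀ v, Nonempty (Ω v)]

/-- The values of the variables in `S` as a function of their parents outside of `S`. -/
noncomputable def solve (S : Set V) (p : ∀ a : {a // a ∉ S ∧ ∃ v ∈ S, M.dir a v}, Ω a)
    (q : {l // ∃ v ∈ S, M.lat l v} → M.W) : ∀ v, Ω v :=
  (M.existsUnique_sat S (fill (α := fun _ => M.W) _ q) (fill _ p)).choose

/-- By locality the arbitrary values inserted by `fill` at non-parents play no role, so the
mechanism of `S` encodes exactly `Sat S`. -/
theorem solve_eq_iff (S : Set V) (z : ∀ v, Ω v) (e : M.Lat → M.W) :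
    (∀ v : S, M.solve S (fun a => z a.1) (fun l => e l.1) v = z v) ↔ M.Sat S e z := by
  classical
  obtain ⟨⟨h1, h2⟩, h3⟩ := (M.existsUnique_sat S
    (fill (α := fun _ => M.W) (fun l => ∃ v ∈ S, M.lat l v) fun l => e l.1)
    (fill (fun a => a ∉ S ∧ ∃ v ∈ S, M.dir a v) fun a => z a.1)).choose_spec
  constructor
  · intro h
    refine M.sat_local S _ _ _ _ ?_ ?_ h2
    · intro v hv
      by_cases hvS : v ∈ S
      · exact h ⟨v, hvS⟩
      · rw [h1 v hvS, fill_of _ ⟨hvS, hv.resolve_left hvS⟩]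
    · intro l hl
      exact fill_of (P := fun l => ∃ v ∈ S, M.lat l v) (α := fun _ => M.W) _ hl
  · intro h v
    have := h3 (fun v => if v ∈ S then z v else
      fill (fun a => a ∉ S ∧ ∃ v ∈ S, M.dir a v) (fun a => z a.1) v) ⟨?_, ?_⟩
    · exact (congrFun this v).symm.trans (if_pos v.2)
    · intro v hv
      simp only [if_neg hv]
    · refine M.sat_local S _ _ _ _ ?_ ?_ h
      · intro v hv
        by_cases hvS : v ∈ S
        · simp only [if_pos hvS]
        · simp only [if_neg hvS]
          rw [fill_of _ ⟨hvS, hv.resolve_left hvS⟩]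
      · intro l hl
        exact (fill_of (P := fun l => ∃ v ∈ S, M.lat l v) (α := fun _ => M.W)
          (fun l => e l.1) hl).symm

/-- The uniform distribution on a finite type. -/
noncomputable def uniformLaw (W : Type) [Fintype W] [Nonempty W] : @Measure W ⊤ :=
  letI : MeasurableSpace W := ⊤
  (PMF.uniformOfFintype W).toMeasure

variable [Finite V] [∀ v, Finite (Ω v)] [∀ v, MeasurableSpace (Ω v)]
  [∀ v, DiscreteMeasurableSpace (Ω v)]

/-- The structural causal model of a system of equations. -/
noncomputable def toIOSCM : IOSCM V Ω where
  input := ∅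
  Lat := M.Lat
  Val _ := M.W
  valMeasurableSpace _ := ⊤
  dir := M.dir
  lat := M.lat
  dir_irrefl := M.dir_irrefl
  dir_not_input _ _ _ h := h
  lat_not_input _ _ _ h := h
  observed_child v _ := .inl (M.exists_lat v)
  mech S _ _ p q v := M.solve S p q v
  mech_measurable S _ _ := by
    let _ : MeasurableSpace M.W := ⊤
    have : DiscreteMeasurableSpace M.W := ⟨fun _ => trivial⟩
    exact Measurable.of_discrete
  mech_compat S' S _ _ _ _ h z e hz :=
    (M.solve_eq_iff S' z e).2 (M.sat_mono S' S e z h.subset ((M.solve_eq_iff S z e).1 hz))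
  law _ := uniformLaw M.W
  law_prob _ := by
    let _ : MeasurableSpace M.W := ⊤
    exact PMF.toMeasure.isProbabilityMeasure _

theorem latentLaw_apply (A : Set (M.Lat → M.W)) :
    M.toIOSCM.latentLaw A = M.weight * A.ncard := by
  classical
  let _ : MeasurableSpace M.W := ⊤
  have : DiscreteMeasurableSpace M.W := ⟨fun _ => trivial⟩
  have : IsProbabilityMeasure (uniformLaw M.W) := PMF.toMeasure.isProbabilityMeasure _
  change (Measure.pi fun _ : M.Lat => uniformLaw M.W) A = M.weight * A.ncard
  have hs : ∀ e, (Measure.pi fun _ : M.Lat => uniformLaw M.W) {e} = M.weight := by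
    intro e
    rw [← Set.univ_pi_singleton, Measure.pi_pi]
    simp [uniformLaw, weight]
  have hfin : A.Finite := Set.toFinite A
  rw [← hfin.coe_toFinset, ← sum_measure_singleton, Finset.sum_congr rfl fun e _ => hs e,
    Finset.sum_const, Set.ncard_coe_finset, nsmul_eq_mul, mul_comm]

theorem isSolution_intervene_of_sat {X : Set V} {x z : ∀ v, Ω v} {e : M.Lat → M.W}
    (hx : ∀ v ∈ X, z v = x v) (hz : M.Sat Xᶜ e z) :
    (M.toIOSCM.intervene X).IsSolution x e z := by
  refine ⟨fun v hv => hx v (hv.resolve_left id), fun S hS hl => ?_⟩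
  exact (M.solve_eq_iff S z e).2 (M.sat_mono S Xᶜ e z (fun v hv h => hS hv (.inr h)) hz)

/-- The set `Xᶜ` need not be a loop. A point satisfying it exists and solves all its loops by
monotonicity; uniqueness of the solution of an ioSCM gives the converse. -/
theorem isSolution_intervene_iff {X : Set V} {x z : ∀ v, Ω v} {e : M.Lat → M.W} :
    (M.toIOSCM.intervene X).IsSolution x e z ↔ (∀ v ∈ X, z v = x v) ∧ M.Sat Xᶜ e z := by
  refine ⟨fun h => ?_, fun h => M.isSolution_intervene_of_sat h.1 h.2⟩
  obtain ⟨y, ⟨hy1, hy2⟩, -⟩ := M.existsUnique_sat Xᶜ e x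
  have hy1 : ∀ v ∈ X, y v = x v := fun v hv => hy1 v fun h => h hv
  obtain rfl := ((M.toIOSCM.intervene X).existsUnique_isSolution x e).unique h
    (M.isSolution_intervene_of_sat hy1 hy2)
  exact ⟨hy1, hy2⟩

theorem isSolution_iff {x z : ∀ v, Ω v} {e : M.Lat → M.W} :
    M.toIOSCM.IsSolution x e z ↔ M.Sat Set.univ e z := by
  have hsol : ∀ z, M.Sat Set.univ e z → M.toIOSCM.IsSolution x e z := fun z hz =>
    ⟨fun v hv => hv.elim, fun S hS hl =>
      (M.solve_eq_iff S z e).2 (M.sat_mono S _ e z (Set.subset_univ S) hz)⟩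
  refine ⟨fun h => ?_, hsol z⟩
  obtain ⟨y, ⟨-, hy2⟩, -⟩ := M.existsUnique_sat Set.univ e x
  obtain rfl := (M.toIOSCM.existsUnique_isSolution x e).unique h (hsol y hy2)
  exact hy2

theorem prob_singleton (x z : ∀ v, Ω v) :
    M.toIOSCM.prob x {z} = M.weight * ({e | M.Sat Set.univ e z} : Set (M.Lat → M.W)).ncard := by
  refine (M.latentLaw_apply _).trans ?_
  congr 3
  ext e
  exact ⟨fun ⟨y, hy, hyz⟩ => M.isSolution_iff.1 (Set.mem_singleton_iff.1 hyz ▸ hy),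
    fun h => ⟨z, M.isSolution_iff.2 h, rfl⟩⟩

theorem doProb_eq (X : Set V) (x : ∀ v, Ω v) (A : Set (∀ v, Ω v)) :
    M.toIOSCM.doProb X x A = M.weight *
      ({e | ∃ z, ((∀ v ∈ X, z v = x v) ∧ M.Sat Xᶜ e z) ∧ z ∈ A} : Set (M.Lat → M.W)).ncard := by
  refine (M.latentLaw_apply _).trans ?_
  congr 3
  ext e
  exact exists_congr fun z => and_congr_left fun _ => M.isSolution_intervene_iff

end EqSystem

/-- Recursive equations along a well-founded relation have a unique solution. -/
theorem WellFounded.existsUnique_forall_eq {K : Type*} {α : K → Type*} {r : K → K → Prop}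
    (hr : WellFounded r) (F : ∀ k, (∀ k, α k) → α k) [∀ k, Nonempty (α k)]
    (hF : ∀ k y y', (∀ k', r k' k → y k' = y' k') → F k y = F k y') :
    ∃! y : ∀ k, α k, ∀ k, y k = F k y := by
  classical
  let G : ∀ k, (∀ k', r k' k → α k') → α k := fun k rec =>
    F k fun k' => if h : r k' k then rec k' h else Classical.arbitrary _
  refine ⟨fun k => hr.fix G k, fun k => ?_, fun y hy => ?_⟩
  · refine (hr.fix_eq G k).trans (hF k _ _ fun k' h => ?_)
    rw [dif_pos h]
  · funext k
    induction k using hr.induction with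
    | _ k ih =>
      rw [hy k, hr.fix_eq]
      refine hF k _ _ fun k' h => ?_
      rw [dif_pos h]
      exact ih k' h

/-! ### Frames: ring coordinates and the selected solution of a ring -/

/-- The common data of the models: rings of coordinates `I` (closed walks, with `prev` as the
predecessor map and `lab` as the ring of a position), binary coordinates `K` of the variables, and
edges `E` between binary coordinates, each with two latent sources of randomness. -/
structure Frame (V : Type u) where
  /-- the edges between variables -/
  dir : V → V → Prop
  dir_irrefl : ∀ v, ¬ dir v v
  /-- the latent variables -/
  Lat : Type
  [latFintype : Fintype Lat]
  /-- the edges from latent to non-latent variables -/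
  lat : Lat → V → Prop
  /-- a private latent variable for each variable -/
  own : V → Lat
  lat_own : ∀ v, lat (own v) v
  /-- the ring positions -/
  I : Type
  [iFintype : Fintype I]
  /-- the edges between binary coordinates -/
  E : Type
  [eFintype : Fintype E]
  /-- the binary coordinates -/
  K : Type
  [kFintype : Fintype K]
  /-- the variable of a ring position -/
  loc : I → V
  /-- the preceding ring position -/
  prev : I → I
  /-- the edge to which a ring belongs -/
  lab : I → E
  lab_prev : ∀ i, lab (prev i) = lab i
  dir_prev : ∀ i, dir (loc (prev i)) (loc i)
  exists_iterate_prev : ∀ i j, lab i = lab j → ∃ k, prev^[k] i = j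
  /-- the variable of a binary coordinate -/
  owner : K → V
  /-- the source of an edge -/
  src : E → K
  /-- the target of an edge -/
  tgt : E → K
  /-- the latent variable that the source uses -/
  srcLat : E → Lat
  /-- the latent variable that the target uses -/
  tgtLat : E → Lat
  lat_srcLat : ∀ j, lat (srcLat j) (owner (src j))
  lat_tgtLat : ∀ j, lat (tgtLat j) (owner (tgt j))
  /-- the ring position that the target uses, if the edge has a ring -/
  pos : E → Option I
  loc_pos : ∀ j i, pos j = some i → loc i = owner (tgt j)
  lab_pos : ∀ j i, pos j = some i → lab i = j
  lat_ne : ∀ j i, pos j = some i → srcLat j ≠ tgtLat j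
  lat_eq : ∀ j, pos j = none → srcLat j = tgtLat j
  exists_srcLat : ∀ i, ∃ i', lab i' = lab i ∧ lat (srcLat (lab i)) (loc i')
  exists_tgtLat : ∀ i, ∃ i', lab i' = lab i ∧ lat (tgtLat (lab i)) (loc i')
  /-- the transport coordinates -/
  Tr : Set K
  /-- the parents of the transport coordinates -/
  trPar : K → K → Prop
  /-- the noisy coordinate that is not a transport coordinate -/
  base : K
  base_notMem : base ∉ Tr
  /-- the roots -/
  root : Set K

namespace Frame

attribute [instance] Frame.latFintype Frame.iFintype Frame.eFintype Frame.kFintype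

variable {V : Type u} (A : Frame V)

/-- The domain of a ring coordinate. -/
abbrev T : Type := ZMod 2 × ZMod (Fintype.card A.I + 1)

/-- The domain of the latent variables. -/
abbrev W : Type :=
  (A.I → A.T) × (A.I → A.T) × (A.E → ZMod 2) × (A.K → ZMod 2) × (A.K → ZMod 3)

/-- The domain of a variable. -/
abbrev Dom (v : V) : Type := ({i // A.loc i = v} → A.T) × ({k // A.owner k = v} → ZMod 2)

/-- The ring coordinates of an assignment. -/
def ring (z : ∀ v, A.Dom v) (i : A.I) : A.T := (z (A.loc i)).1 ⟨i, rfl⟩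

/-- The binary coordinates of an assignment. -/
def bit (z : ∀ v, A.Dom v) (k : A.K) : ZMod 2 := (z (A.owner k)).2 ⟨k, rfl⟩

/-- The assignment with given coordinates. -/
def assign (r : A.I → A.T) (b : A.K → ZMod 2) (v : V) : A.Dom v := (fun i => r i.1, fun k => b k.1)

@[simp] theorem ring_assign (r : A.I → A.T) (b : A.K → ZMod 2) : A.ring (A.assign r b) = r := rfl

@[simp] theorem bit_assign (r : A.I → A.T) (b : A.K → ZMod 2) : A.bit (A.assign r b) = b := rfl

@[simp] theorem assign_ring_bit (z : ∀ v, A.Dom v) : A.assign (A.ring z) (A.bit z) = z := by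
  funext v
  refine Prod.ext ?_ ?_ <;> · funext ⟨i, hi⟩; subst hi; rfl

theorem eq_on_iff (S : Set V) (z z' : ∀ v, A.Dom v) :
    (∀ v ∈ S, z v = z' v) ↔
      (∀ i, A.loc i ∈ S → A.ring z i = A.ring z' i) ∧
        ∀ k, A.owner k ∈ S → A.bit z k = A.bit z' k := by
  constructor
  · exact fun h => ⟨fun i hi => by simp only [ring, h _ hi], fun k hk => by simp only [bit, h _ hk]⟩
  · rintro ⟨h1, h2⟩ v hv
    refine Prod.ext ?_ ?_
    · funext ⟨i, hi⟩; subst hi; exact h1 i hv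
    · funext ⟨i, hi⟩; subst hi; exact h2 i hv

/-- The value at which the equation of a ring position does not copy. -/
def inp (e : A.Lat → A.W) (i : A.I) : A.T := (e (A.own (A.loc i))).1 i

/-- The value that replaces the exceptional value. -/
def out (e : A.Lat → A.W) (i : A.I) : A.T := (e (A.own (A.loc i))).2.1 i

/-- The coin of the source of an edge. -/
def srcCoin (e : A.Lat → A.W) (j : A.E) : ZMod 2 := (e (A.srcLat j)).2.2.1 j

/-- The coin of the target of an edge. -/
def tgtCoin (e : A.Lat → A.W) (j : A.E) : ZMod 2 := (e (A.tgtLat j)).2.2.1 j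

/-- The private coin of a binary coordinate. -/
def coin (e : A.Lat → A.W) (k : A.K) : ZMod 2 := (e (A.own (A.owner k))).2.2.2.1 k

/-- The source of the noise of a binary coordinate. -/
def rawNoise (e : A.Lat → A.W) (k : A.K) : ZMod 3 := (e (A.own (A.owner k))).2.2.2.2 k

/-- Biased noise. -/
def noise (e : A.Lat → A.W) (k : A.K) : ZMod 2 := if A.rawNoise e k = 0 then 1 else 0

open scoped Classical in
/-- The identity map, changed at one point. -/
noncomputable def hop (p q t : A.T) : A.T := if t = p then q else t

/-- Pigeonhole: there are `card I + 1` labels for each parity and at most `card I` exceptional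
values. -/
theorem exists_fresh (a : A.I → A.T) (s : ZMod 2) (j : A.E) :
    ∃ k : ZMod (Fintype.card A.I + 1), ∀ i, A.lab i = j → a i ≠ (s, k) := by
  by_contra! h
  choose f _ hf using h
  have hinj : Function.Injective f := fun k k' hk => by
    have := (hf k).symm.trans (hk ▸ hf k')
    exact (Prod.ext_iff.1 this).2
  have := Fintype.card_le_of_injective f hinj
  rw [ZMod.card] at this
  omega

open scoped Classical in
/-- The solution of the equations of the ring `j` that is selected: its parity at `pos j` is `s`. -/
noncomputable def sel (a b : A.I → A.T) (s : ZMod 2) (j : A.E) (i : A.I) : A.T :=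
  if (∀ i, A.lab i = j → a i = b (A.prev i)) ∧ (∀ i, A.pos j = some i → (b i).1 = s) then b i
  else (s, Classical.epsilon fun k => ∀ i, A.lab i = j → a i ≠ (s, k))

/-- In the first case of `sel` every position meets its exceptional value and replaces it by `b i`;
this case gives the ring full support. In the second case a constant that avoids all exceptional
values of the ring is copied around. -/
theorem hop_sel (a b : A.I → A.T) (s : ZMod 2) (i : A.I) :
    A.hop (a i) (b i) (A.sel a b s (A.lab i) (A.prev i)) = A.sel a b s (A.lab i) i := by
  unfold sel hop
  split_ifs with h h1 h2
  · rfl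
  · exact absurd (h.1 i rfl).symm h1
  · exact absurd h2.symm (Classical.epsilon_spec (A.exists_fresh a s (A.lab i)) i rfl)
  · rfl

theorem sel_pos (a b : A.I → A.T) (s : ZMod 2) {j : A.E} {i : A.I} (h : A.pos j = some i) :
    (A.sel a b s j i).1 = s := by
  unfold sel
  split_ifs with h1
  · exact h1.2 i h
  · rfl

theorem sel_self (a b : A.I → A.T) (s : ZMod 2) (j : A.E) (i : A.I)
    (h : ∀ i, A.lab i = j → a i = b (A.prev i)) (hs : ∀ i, A.pos j = some i → (b i).1 = s) :
    A.sel a b s j i = b i := if_pos ⟨h, hs⟩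

theorem sel_congr {a b a' b' : A.I → A.T} (s : ZMod 2) {j : A.E}
    (ha : ∀ i, A.lab i = j → a i = a' i) (hb : ∀ i, A.lab i = j → b i = b' i) {i : A.I}
    (hi : A.lab i = j) : A.sel a b s j i = A.sel a' b' s j i := by
  have h1 : (∀ i, A.lab i = j → a i = b (A.prev i)) ↔
      (∀ i, A.lab i = j → a' i = b' (A.prev i)) :=
    forall₂_congr fun i hi => by rw [ha i hi, hb _ ((A.lab_prev i).trans hi)]
  have h2 : (∀ i, A.pos j = some i → (b i).1 = s) ↔ (∀ i, A.pos j = some i → (b' i).1 = s) :=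
    forall₂_congr fun i hi => by rw [hb i (A.lab_pos j i hi)]
  have h3 : (fun k => ∀ i, A.lab i = j → a i ≠ (s, k)) =
      fun k : ZMod (Fintype.card A.I + 1) => ∀ i, A.lab i = j → a' i ≠ (s, k) :=
    funext fun k => propext (forall₂_congr fun i hi => by rw [ha i hi])
  unfold sel
  classical
  exact ite_congr (propext (and_congr h1 h2)) (fun _ => hb i hi)
    fun _ => congrArg (fun p => (s, Classical.epsilon p)) h3

/-- The parity that the ring `j` has to have. -/
def charge (e : A.Lat → A.W) (j : A.E) : ZMod 2 := A.srcCoin e j + A.tgtCoin e j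

/-- The selected values of the ring coordinates. -/
noncomputable def selected (e : A.Lat → A.W) (i : A.I) : A.T :=
  A.sel (A.inp e) (A.out e) (A.charge e (A.lab i)) (A.lab i) i

/-- The ring `j` lies in `S`. -/
def Full (S : Set V) (j : A.E) : Prop := ∀ i, A.lab i = j → A.loc i ∈ S

/-- The parity of the ring of an edge. -/
def ringBit (r : A.I → A.T) (j : A.E) : ZMod 2 := (A.pos j).elim 0 fun i => (r i).1

/-- For an edge without ring the two coins are one coin and cancel; for an edge with a ring the
parity at `pos j` was selected to be their sum. -/
theorem charge_eq_ringBit {e : A.Lat → A.W} {r : A.I → A.T} {j : A.E}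
    (h : ∀ i, A.lab i = j → r i = A.selected e i) : A.charge e j = A.ringBit r j := by
  unfold ringBit
  cases hp : A.pos j with
  | none =>
    simp only [charge, srcCoin, tgtCoin, A.lat_eq j hp, Option.elim]
    exact CharTwo.add_self_eq_zero _
  | some i =>
    have hl := A.lab_pos j i hp
    subst hl
    simp only [Option.elim]
    rw [h i rfl]
    exact (A.sel_pos _ _ _ hp).symm

end Frame

/-! ### Wirings: solvability, monotonicity and locality of the equations -/

/-- The wiring of the binary coordinates: a forest `par` on the coordinates in `H` and the edges
`act` that are used. The other coordinates are private coins. -/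
structure Wiring {V : Type u} (A : Frame V) where
  /-- the coordinates of the forest -/
  H : Set A.K
  /-- `par u k` says that `k` is the child of `u` -/
  par : A.K → A.K → Prop
  /-- the edges in use -/
  act : Set A.E
  par_dir : ∀ u k, par u k → A.dir (A.owner u) (A.owner k) ∨ A.owner u = A.owner k
  par_wf : WellFounded par
  par_mem : ∀ u k, par u k → u ∈ H ∧ k ∈ H
  par_unique : ∀ u k k', par u k → par u k' → k = k'
  act_mem : ∀ j ∈ act, A.src j ∈ H ∧ A.tgt j ∈ H
  act_notMem : ∀ j ∈ act, A.src j ∉ A.Tr ∧ A.tgt j ∉ A.Tr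
  tr_subset : A.Tr ⊆ H
  base_mem : A.base ∈ H
  par_tr : ∀ u, ∀ k ∈ A.Tr, par u k ↔ A.trPar u k
  mem_root : ∀ k, k ∈ A.root ↔ k ∈ H ∧ ∀ k', ¬ par k k'
  connected : ∀ k ∈ H, k ∉ A.Tr → ∀ k' ∈ H, k' ∉ A.Tr → ReflTransGen
    (fun p q => ∃ j ∈ act, A.src j = p ∧ A.tgt j = q ∨ A.src j = q ∧ A.tgt j = p) k k'

namespace Wiring

open scoped Classical

variable {V : Type u} {A : Frame V} (w : Wiring A)

/-- The sum over the parents. -/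
noncomputable def parSum (b : A.K → ZMod 2) (k : A.K) : ZMod 2 :=
  ∑ u, if w.par u k then b u else 0

/-- The contribution of the coins of the edges. -/
noncomputable def lin (e : A.Lat → A.W) (k : A.K) : ZMod 2 :=
  ∑ j, if j ∈ w.act then
    (if A.src j = k then A.srcCoin e j else 0) + (if A.tgt j = k then A.tgtCoin e j else 0) else 0

/-- The contribution of the rings. -/
noncomputable def ringSum (r : A.I → A.T) (k : A.K) : ZMod 2 :=
  ∑ j, if j ∈ w.act then (if A.tgt j = k then A.ringBit r j else 0) else 0

/-- The right-hand side of the equation of a binary coordinate. -/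
noncomputable def rhs (e : A.Lat → A.W) (r : A.I → A.T) (b : A.K → ZMod 2) (k : A.K) : ZMod 2 :=
  if k ∈ w.H then
    w.parSum b k + (w.lin e k + w.ringSum r k) + (if k ∈ insert A.base A.Tr then A.noise e k else 0)
  else A.coin e k

/-- The right-hand side of the equation of a ring coordinate. -/
noncomputable def _root_.Frame.ringRhs (A : Frame V) (S : Set V) (e : A.Lat → A.W) (r : A.I → A.T)
    (i : A.I) : A.T :=
  if A.Full S (A.lab i) then A.selected e i else A.hop (A.inp e i) (A.out e i) (r (A.prev i))

/-- The equations of the variables in `S`. -/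
def Sat (S : Set V) (e : A.Lat → A.W) (z : ∀ v, A.Dom v) : Prop :=
  (∀ i, A.loc i ∈ S → A.ring z i = A.ringRhs S e (A.ring z) i) ∧
    ∀ k, A.owner k ∈ S → A.bit z k = w.rhs e (A.ring z) (A.bit z) k

/-- A ring inside `S` is prescribed outright. A ring that leaves `S` is no longer cyclic: its values
propagate forward from the positions outside `S`. -/
theorem existsUnique_ring (S : Set V) (e : A.Lat → A.W) (r₀ : A.I → A.T) :
    ∃! r : A.I → A.T, ∀ i, r i = if A.loc i ∈ S then A.ringRhs S e r i else r₀ i := by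
  have hex : ∀ i, ¬ A.Full S (A.lab i) → ∃ k, A.loc (A.prev^[k] i) ∉ S := by
    intro i hi
    unfold Frame.Full at hi
    push Not at hi
    obtain ⟨i', hi', hS⟩ := hi
    obtain ⟨k, hk⟩ := A.exists_iterate_prev i i' hi'.symm
    exact ⟨k, hk ▸ hS⟩
  -- The number of backward steps needed to leave `S`; it drops along `prev`.
  let rank : A.I → ℕ := fun i => if h : ¬ A.Full S (A.lab i) then Nat.find (hex i h) else 0
  let r : A.I → A.I → Prop := fun i' i => i' = A.prev i ∧ A.loc i ∈ S ∧ ¬ A.Full S (A.lab i)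
  have hr : WellFounded r := by
    refine Subrelation.wf (r := fun i' i => rank i' < rank i) ?_ (InvImage.wf rank Nat.lt_wfRel.wf)
    rintro i' i ⟨rfl, hi, hf⟩
    have hf' : ¬ A.Full S (A.lab (A.prev i)) := by rwa [A.lab_prev]
    change rank _ < rank _
    simp only [rank, dif_pos hf, dif_pos hf']
    have h0 : Nat.find (hex i hf) ≠ 0 := fun h0 => by
      have := Nat.find_spec (hex i hf)
      rw [h0] at this
      exact this hi
    obtain ⟨m, hm⟩ := Nat.exists_eq_succ_of_ne_zero h0
    have hspec := Nat.find_spec (hex i hf)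
    rw [hm, Function.iterate_succ_apply] at hspec
    have : Nat.find (hex (A.prev i) hf') ≤ m := Nat.find_min' _ hspec
    omega
  refine hr.existsUnique_forall_eq
    (fun i (r : A.I → A.T) => if A.loc i ∈ S then A.ringRhs S e r i else r₀ i) ?_
  intro i y y' h
  by_cases hi : A.loc i ∈ S
  · simp only [if_pos hi, Frame.ringRhs]
    split_ifs with hf
    · rfl
    · rw [h _ ⟨rfl, hi, hf⟩]
  · simp only [if_neg hi]

theorem parSum_congr {b b' : A.K → ZMod 2} {k : A.K} (h : ∀ u, w.par u k → b u = b' u) :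
    w.parSum b k = w.parSum b' k :=
  Finset.sum_congr rfl fun u _ => by
    split_ifs with hu
    · exact h u hu
    · rfl

theorem existsUnique_bit (S : Set V) (e : A.Lat → A.W) (r : A.I → A.T) (b₀ : A.K → ZMod 2) :
    ∃! b : A.K → ZMod 2, ∀ k, b k = if A.owner k ∈ S then w.rhs e r b k else b₀ k := by
  refine w.par_wf.existsUnique_forall_eq
    (fun k (b : A.K → ZMod 2) => if A.owner k ∈ S then w.rhs e r b k else b₀ k) ?_
  intro k y y' h
  simp only [rhs]
  rw [w.parSum_congr h]

theorem forall_eq_ite_iff {ι α : Type*} {P : ι → Prop} {f g h : ι → α} :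
    (∀ i, f i = if P i then g i else h i) ↔
      (∀ i, ¬ P i → f i = h i) ∧ ∀ i, P i → f i = g i := by
  constructor
  · exact fun H => ⟨fun i hi => by rw [H i, if_neg hi], fun i hi => by rw [H i, if_pos hi]⟩
  · rintro ⟨h1, h2⟩ i
    split_ifs with hi
    · exact h2 i hi
    · exact h1 i hi

theorem eq_off_and_sat_iff (S : Set V) (e : A.Lat → A.W) (z y : ∀ v, A.Dom v) :
    ((∀ v, v ∉ S → y v = z v) ∧ w.Sat S e y) ↔
      (∀ i, A.ring y i = if A.loc i ∈ S then A.ringRhs S e (A.ring y) i else A.ring z i) ∧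
      ∀ k, A.bit y k = if A.owner k ∈ S then w.rhs e (A.ring y) (A.bit y) k else A.bit z k := by
  rw [forall_eq_ite_iff, forall_eq_ite_iff]
  have := A.eq_on_iff Sᶜ y z
  simp only [Set.mem_compl_iff] at this
  rw [this]
  unfold Sat
  tauto

theorem existsUnique_sat (S : Set V) (e : A.Lat → A.W) (z : ∀ v, A.Dom v) :
    ∃! y : ∀ v, A.Dom v, (∀ v, v ∉ S → y v = z v) ∧ w.Sat S e y := by
  obtain ⟨r, hr, hr'⟩ := existsUnique_ring S e (A.ring z)
  obtain ⟨b, hb, hb'⟩ := w.existsUnique_bit S e r (A.bit z)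
  refine ⟨A.assign r b, (w.eq_off_and_sat_iff S e z _).2 ⟨hr, hb⟩, fun y hy => ?_⟩
  obtain ⟨h1, h2⟩ := (w.eq_off_and_sat_iff S e z y).1 hy
  have h3 := hr' _ h1
  rw [h3] at h2
  rw [← A.assign_ring_bit y, h3, hb' _ h2]

/-- The only rings whose equations change are those inside `S` but not inside `S'`; there `hop_sel`
shows that the selected solution obeys the copying equations. -/
theorem sat_mono (S' S : Set V) (e : A.Lat → A.W) (z : ∀ v, A.Dom v) (hS : S' ⊆ S)
    (h : w.Sat S e z) : w.Sat S' e z := by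
  refine ⟨fun i hi => ?_, fun k hk => h.2 k (hS hk)⟩
  have h1 := h.1 i (hS hi)
  unfold Frame.ringRhs at h1 ⊢
  by_cases hf : A.Full S (A.lab i)
  · have hp := h.1 (A.prev i) (hf _ (A.lab_prev i))
    unfold Frame.ringRhs at hp
    rw [A.lab_prev, if_pos hf] at hp
    rw [if_pos hf] at h1
    rw [h1, hp]
    split_ifs
    · rfl
    · unfold Frame.selected
      rw [A.lab_prev]
      exact (A.hop_sel _ _ _ i).symm
  · have hf' : ¬ A.Full S' (A.lab i) := fun h' => hf fun i' hi' => hS (h' i' hi')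
    rw [if_neg hf] at h1
    rw [if_neg hf']
    exact h1

theorem sat_local (S : Set V) (e e' : A.Lat → A.W) (z z' : ∀ v, A.Dom v)
    (hz : ∀ v, (v ∈ S ∨ ∃ w ∈ S, A.dir v w) → z v = z' v)
    (he : ∀ l, (∃ v ∈ S, A.lat l v) → e l = e' l) (h : w.Sat S e z) : w.Sat S e' z' := by
  have hr : ∀ i, (A.loc i ∈ S ∨ ∃ w ∈ S, A.dir (A.loc i) w) → A.ring z i = A.ring z' i :=
    fun i hi => by simp only [Frame.ring, hz _ hi]
  have hb : ∀ k, (A.owner k ∈ S ∨ ∃ w ∈ S, A.dir (A.owner k) w) → A.bit z k = A.bit z' k :=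
    fun k hk => by simp only [Frame.bit, hz _ hk]
  have hown : ∀ v ∈ S, e (A.own v) = e' (A.own v) := fun v hv => he _ ⟨v, hv, A.lat_own v⟩
  have hinp : ∀ i, A.loc i ∈ S → A.inp e i = A.inp e' i :=
    fun i hi => by simp only [Frame.inp, hown _ hi]
  have hout : ∀ i, A.loc i ∈ S → A.out e i = A.out e' i :=
    fun i hi => by simp only [Frame.out, hown _ hi]
  constructor
  · intro i hi
    have h1 := h.1 i hi
    rw [← hr i (.inl hi), h1]
    unfold Frame.ringRhs
    by_cases hf : A.Full S (A.lab i)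
    · rw [if_pos hf, if_pos hf]
      have hc : A.charge e (A.lab i) = A.charge e' (A.lab i) := by
        -- The ring visits variables that have the two coin-carrying latent variables as parents, so
        -- a set containing the ring may read both coins although no single variable need do so.
        obtain ⟨i1, hl1, hi1⟩ := A.exists_srcLat i
        obtain ⟨i2, hl2, hi2⟩ := A.exists_tgtLat i
        simp only [Frame.charge, Frame.srcCoin, Frame.tgtCoin, he _ ⟨_, hf i1 hl1, hi1⟩,
          he _ ⟨_, hf i2 hl2, hi2⟩]
      unfold Frame.selected
      rw [hc]
      exact A.sel_congr _ (fun i' hi' => hinp i' (hf i' hi')) (fun i' hi' => hout i' (hf i' hi')) rfl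
    · rw [if_neg hf, if_neg hf, hinp i hi, hout i hi, hr _ (.inr ⟨_, hi, A.dir_prev i⟩)]
  · intro k hk
    rw [← hb k (.inl hk), h.2 k hk]
    have h1 : w.parSum (A.bit z) k = w.parSum (A.bit z') k := w.parSum_congr fun u hu =>
      hb u <| (w.par_dir u k hu).elim (fun h => .inr ⟨_, hk, h⟩) fun h => .inl (h ▸ hk)
    have h2 : w.lin e k = w.lin e' k := Finset.sum_congr rfl fun j _ => by
      refine ite_congr rfl (fun _ => congrArg₂ _ (ite_congr rfl (fun hj => ?_) fun _ => rfl)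
        (ite_congr rfl (fun hj => ?_) fun _ => rfl)) fun _ => rfl
      · exact congrArg (fun x : A.W => x.2.2.1 j) (he _ ⟨_, hj ▸ hk, A.lat_srcLat j⟩)
      · exact congrArg (fun x : A.W => x.2.2.1 j) (he _ ⟨_, hj ▸ hk, A.lat_tgtLat j⟩)
    have h3 : w.ringSum (A.ring z) k = w.ringSum (A.ring z') k := Finset.sum_congr rfl fun j _ => by
      refine ite_congr rfl (fun _ => ite_congr rfl (fun hj => ?_) fun _ => rfl) fun _ => rfl
      unfold Frame.ringBit
      cases hp : A.pos j with
      | none => rfl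
      | some i => exact congrArg Prod.fst (hr i (.inl (by rw [A.loc_pos j i hp, hj]; exact hk)))
    have h4 : A.noise e k = A.noise e' k := by
      have : A.rawNoise e k = A.rawNoise e' k := by simp only [Frame.rawNoise, hown _ hk]
      rw [Frame.noise, Frame.noise, this]
    have h5 : A.coin e k = A.coin e' k := by simp only [Frame.coin, hown _ hk]
    rw [rhs, rhs, h1, h2, h3, h4, h5]

end Wiring

/-! ### Neutral shifts of the latent variables -/

namespace Frame

variable {V : Type u} (A : Frame V)

/-- The changes of the latent variables that do not affect the rings and the noise. -/
def Neutral (δ : A.Lat → A.W) : Prop :=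
  (∀ l, (δ l).1 = 0 ∧ (δ l).2.1 = 0 ∧ (δ l).2.2.2.2 = 0) ∧ ∀ j, A.charge δ j = 0

variable {A}

theorem charge_add (e δ : A.Lat → A.W) (j : A.E) :
    A.charge (e + δ) j = A.charge e j + A.charge δ j :=
  add_add_add_comm _ _ _ _

theorem selected_congr {e e' : A.Lat → A.W} (h1 : A.inp e = A.inp e') (h2 : A.out e = A.out e')
    (h3 : A.charge e = A.charge e') : A.selected e = A.selected e' := by
  funext i
  rw [selected, selected, h1, h2, h3]

namespace Neutral

variable {δ : A.Lat → A.W}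

theorem inp_add (h : A.Neutral δ) (e : A.Lat → A.W) : A.inp (e + δ) = A.inp e := by
  funext i
  simp [inp, (h.1 _).1]

theorem out_add (h : A.Neutral δ) (e : A.Lat → A.W) : A.out (e + δ) = A.out e := by
  funext i
  simp [out, (h.1 _).2.1]

theorem charge_add (h : A.Neutral δ) (e : A.Lat → A.W) : A.charge (e + δ) = A.charge e := by
  funext j
  rw [Frame.charge_add, h.2, add_zero]

theorem noise_add (h : A.Neutral δ) (e : A.Lat → A.W) : A.noise (e + δ) = A.noise e := by
  funext k
  have : A.rawNoise (e + δ) k = A.rawNoise e k := by simp [rawNoise, (h.1 _).2.2]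
  rw [noise, noise, this]

theorem selected_add (h : A.Neutral δ) (e : A.Lat → A.W) : A.selected (e + δ) = A.selected e :=
  selected_congr (h.inp_add e) (h.out_add e) (h.charge_add e)

theorem ringRhs_add (h : A.Neutral δ) (e : A.Lat → A.W) (S : Set V) (r : A.I → A.T) (i : A.I) :
    A.ringRhs S (e + δ) r i = A.ringRhs S e r i := by
  rw [ringRhs, ringRhs, h.selected_add, h.inp_add, h.out_add]

end Neutral

theorem neutral_zero : A.Neutral 0 :=
  ⟨fun _ => ⟨rfl, rfl, rfl⟩, fun _ => add_zero _⟩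

theorem Neutral.add {δ δ' : A.Lat → A.W} (h : A.Neutral δ) (h' : A.Neutral δ') :
    A.Neutral (δ + δ') := by
  refine ⟨fun l => ⟨?_, ?_, ?_⟩, fun j => ?_⟩
  · simp [(h.1 l).1, (h'.1 l).1]
  · simp [(h.1 l).2.1, (h'.1 l).2.1]
  · simp [(h.1 l).2.2, (h'.1 l).2.2]
  · rw [Frame.charge_add, h.2, h'.2, add_zero]

variable (A)

open scoped Classical in
/-- Flip the coins of both ends of an edge. -/
noncomputable def edgeShift (j : A.E) (l : A.Lat) : A.W :=
  (0, 0, if l = A.srcLat j ∨ l = A.tgtLat j then Pi.single j 1 else 0, 0, 0)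

theorem srcCoin_edgeShift_self (j : A.E) : A.srcCoin (A.edgeShift j) j = 1 := by
  simp [srcCoin, edgeShift]

theorem tgtCoin_edgeShift_self (j : A.E) : A.tgtCoin (A.edgeShift j) j = 1 := by
  simp [tgtCoin, edgeShift]

theorem srcCoin_edgeShift_of_ne {j j' : A.E} (h : j' ≠ j) : A.srcCoin (A.edgeShift j) j' = 0 := by
  unfold srcCoin edgeShift
  split_ifs <;> simp [h]

theorem tgtCoin_edgeShift_of_ne {j j' : A.E} (h : j' ≠ j) : A.tgtCoin (A.edgeShift j) j' = 0 := by
  unfold tgtCoin edgeShift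
  split_ifs <;> simp [h]

theorem coin_edgeShift (j : A.E) (k : A.K) : A.coin (A.edgeShift j) k = 0 := rfl

theorem neutral_edgeShift (j : A.E) : A.Neutral (A.edgeShift j) := by
  refine ⟨fun _ => ⟨rfl, rfl, rfl⟩, fun j' => ?_⟩
  unfold charge
  by_cases h : j' = j
  · subst h
    rw [srcCoin_edgeShift_self, tgtCoin_edgeShift_self]
    rfl
  · rw [A.srcCoin_edgeShift_of_ne h, A.tgtCoin_edgeShift_of_ne h, add_zero]

open scoped Classical in
/-- Flip the private coin of a binary coordinate. -/
noncomputable def coinShift (k : A.K) (l : A.Lat) : A.W :=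
  (0, 0, 0, if l = A.own (A.owner k) then Pi.single k 1 else 0, 0)

theorem neutral_coinShift (k : A.K) : A.Neutral (A.coinShift k) :=
  ⟨fun _ => ⟨rfl, rfl, rfl⟩, fun _ => add_zero _⟩

open scoped Classical in
theorem coin_coinShift (k k' : A.K) :
    A.coin (A.coinShift k) k' = (Pi.single k 1 : A.K → ZMod 2) k' := by
  unfold coin coinShift
  by_cases h : k' = k
  · subst h
    simp
  · split_ifs <;> simp [h]

open scoped Classical in
/-- The noise of the noisy coordinates. -/
noncomputable def noiseVec (e : A.Lat → A.W) (k : A.K) : ZMod 2 :=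
  if k ∈ insert A.base A.Tr then A.noise e k else 0

open scoped Classical in
/-- The noise of the transport coordinates as a function of the observed values. -/
noncomputable def trNoise (b : A.K → ZMod 2) (k : A.K) : ZMod 2 :=
  if k ∈ A.Tr then b k + ∑ u, (if A.trPar u k then b u else 0) else 0

open scoped Classical in
/-- The sum over the roots. -/
noncomputable def rootSum (b : A.K → ZMod 2) : ZMod 2 := ∑ k, if k ∈ A.root then b k else 0

open scoped Classical in
/-- The noise as a function of the observed values. -/
noncomputable def obsNoise (b : A.K → ZMod 2) (k : A.K) : ZMod 2 :=
  if k = A.base then A.rootSum b + ∑ k, A.trNoise b k else A.trNoise b k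

end Frame

/-! ### Parity of the roots: telescoping along the forest -/

namespace Wiring

open scoped Classical

variable {V : Type u} {A : Frame V} (w : Wiring A)

theorem parSum_add (b b' : A.K → ZMod 2) (k : A.K) :
    w.parSum (b + b') k = w.parSum b k + w.parSum b' k := by
  unfold parSum
  rw [← Finset.sum_add_distrib]
  refine Finset.sum_congr rfl fun u _ => ?_
  split_ifs <;> simp

theorem lin_add (e δ : A.Lat → A.W) (k : A.K) : w.lin (e + δ) k = w.lin e k + w.lin δ k := by
  unfold lin
  rw [← Finset.sum_add_distrib]
  refine Finset.sum_congr rfl fun j _ => ?_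
  have h1 : A.srcCoin (e + δ) j = A.srcCoin e j + A.srcCoin δ j := rfl
  have h2 : A.tgtCoin (e + δ) j = A.tgtCoin e j + A.tgtCoin δ j := rfl
  rw [h1, h2]
  split_ifs <;> ring

/-- If `B` is closed under children and contains the roots, and `b` vanishes on the parents of
elements of `B` that are not in `B`, then the sum of the defects over `B` is the sum over the
roots. -/
theorem sum_defect (B : Set A.K) (hBH : B ⊆ w.H) (hroot : A.root ⊆ B)
    (hB : ∀ u k, u ∈ B → w.par u k → k ∈ B) (b : A.K → ZMod 2)
    (hb : ∀ u k, u ∉ B → w.par u k → k ∈ B → b u = 0) :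
    (∑ k, if k ∈ B then b k + w.parSum b k else 0) = A.rootSum b := by
  have h1 : (∑ k, if k ∈ B then w.parSum b k else 0) =
      ∑ u, if u ∈ B ∧ u ∉ A.root then b u else 0 := by
    have : ∀ k, (if k ∈ B then w.parSum b k else 0) =
        ∑ u, if k ∈ B ∧ w.par u k then b u else 0 := by
      intro k
      by_cases hk : k ∈ B <;> simp [hk, parSum]
    rw [Finset.sum_congr rfl fun k _ => this k, Finset.sum_comm]
    refine Finset.sum_congr rfl fun u _ => ?_
    by_cases hu : u ∈ B
    · by_cases hr : u ∈ A.root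
      · have := ((w.mem_root u).1 hr).2
        simp [hr, this]
      · have hex : ∃ k, w.par u k := by
          by_contra! h
          exact hr ((w.mem_root u).2 ⟨hBH hu, h⟩)
        obtain ⟨k, hk⟩ := hex
        -- A coordinate of `B` that is not a root is counted once as the parent of its unique child
        -- and once as itself; modulo 2 only the roots remain.
        rw [if_pos ⟨hu, hr⟩, Finset.sum_eq_single k, if_pos ⟨hB u k hu hk, hk⟩]
        · exact fun k' _ hk' => if_neg fun h => hk' (w.par_unique u k' k h.2 hk)
        · exact fun h => (h (Finset.mem_univ k)).elim
    · rw [if_neg fun h => hu h.1]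
      refine Finset.sum_eq_zero fun k _ => ?_
      split_ifs with h
      · exact hb u k hu h.2 h.1
      · rfl
  have h2 : (∑ k, if k ∈ B then b k + w.parSum b k else 0) =
      (∑ k, if k ∈ B then b k else 0) + ∑ k, if k ∈ B then w.parSum b k else 0 := by
    rw [← Finset.sum_add_distrib]
    refine Finset.sum_congr rfl fun k _ => ?_
    split_ifs <;> simp
  rw [h2, h1, ← Finset.sum_add_distrib]
  refine Finset.sum_congr rfl fun k _ => ?_
  by_cases hk : k ∈ A.root
  · simp [hk, hroot hk]
  · by_cases hk' : k ∈ B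
    · simpa [hk, hk'] using CharTwo.add_self_eq_zero (b k)
    · simp [hk, hk']

/-- The sum over a set of coordinates, edge by edge. -/
theorem sum_lin (B : Set A.K) (e : A.Lat → A.W) :
    (∑ k, if k ∈ B then w.lin e k else 0) =
      ∑ j, if j ∈ w.act then (if A.src j ∈ B then A.srcCoin e j else 0) +
        (if A.tgt j ∈ B then A.tgtCoin e j else 0) else 0 := by
  have : ∀ k, (if k ∈ B then w.lin e k else 0) = ∑ j, if j ∈ w.act then
      (if A.src j = k then if A.src j ∈ B then A.srcCoin e j else 0 else 0) +
        (if A.tgt j = k then if A.tgt j ∈ B then A.tgtCoin e j else 0 else 0) else 0 := by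
    intro k
    by_cases hk : k ∈ B
    · rw [if_pos hk]
      refine Finset.sum_congr rfl fun j _ => ite_congr rfl (fun _ => congrArg₂ _
        (ite_congr rfl (fun hj => ?_) fun _ => rfl) (ite_congr rfl (fun hj => ?_) fun _ => rfl))
        fun _ => rfl
      · rw [if_pos (hj ▸ hk)]
      · rw [if_pos (hj ▸ hk)]
    · rw [if_neg hk]
      refine (Finset.sum_eq_zero fun j _ => ?_).symm
      have h1 : A.src j = k → A.src j ∉ B := fun h => h ▸ hk
      have h2 : A.tgt j = k → A.tgt j ∉ B := fun h => h ▸ hk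
      split_ifs <;> simp_all
  rw [Finset.sum_congr rfl fun k _ => this k, Finset.sum_comm]
  refine Finset.sum_congr rfl fun j _ => ?_
  split_ifs with hj
  all_goals simp [Finset.sum_add_distrib]

theorem sum_ringSum (r : A.I → A.T) :
    (∑ k, if k ∈ w.H then w.ringSum r k else 0) =
      ∑ j, if j ∈ w.act then A.ringBit r j else 0 := by
  have : ∀ k, (if k ∈ w.H then w.ringSum r k else 0) = ∑ j, if j ∈ w.act then
      (if A.tgt j = k then A.ringBit r j else 0) else 0 := by
    intro k
    by_cases hk : k ∈ w.H
    · rw [if_pos hk]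
      rfl
    · rw [if_neg hk]
      refine (Finset.sum_eq_zero fun j _ => ?_).symm
      split_ifs with hj h
      · exact absurd (h ▸ (w.act_mem j hj).2) hk
      · rfl
      · rfl
  rw [Finset.sum_congr rfl fun k _ => this k, Finset.sum_comm]
  refine Finset.sum_congr rfl fun j _ => ?_
  split_ifs <;> simp

/-- Each edge in use contributes its two coins and, at its target, the ring parity, which is their
sum. -/
theorem sum_lin_add_ringSum {e : A.Lat → A.W} {r : A.I → A.T}
    (h : ∀ j ∈ w.act, A.charge e j = A.ringBit r j) :
    (∑ k, if k ∈ w.H then w.lin e k + w.ringSum r k else 0) = 0 := by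
  have : ∀ k, (if k ∈ w.H then w.lin e k + w.ringSum r k else 0) =
      (if k ∈ w.H then w.lin e k else 0) + if k ∈ w.H then w.ringSum r k else 0 := fun k => by
    split_ifs <;> simp
  rw [Finset.sum_congr rfl fun k _ => this k, Finset.sum_add_distrib, w.sum_lin, w.sum_ringSum,
    ← Finset.sum_add_distrib]
  refine Finset.sum_eq_zero fun j _ => ?_
  by_cases hj : j ∈ w.act
  · have h1 := w.act_mem j hj
    have h2 := h j hj
    rw [Frame.charge] at h2
    simp only [if_pos hj, if_pos h1.1, if_pos h1.2, h2]
    exact CharTwo.add_self_eq_zero _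
  · simp [hj]

/-- If the forest and the rings in use lie in `S`, then the sum over the roots is the total
noise. -/
theorem rootSum_eq {S : Set V} {e : A.Lat → A.W} {z : ∀ v, A.Dom v} (h : w.Sat S e z)
    (hH : ∀ k ∈ w.H, A.owner k ∈ S) (hring : ∀ j ∈ w.act, A.Full S j) :
    A.rootSum (A.bit z) = ∑ k, A.noiseVec e k := by
  rw [← w.sum_defect w.H subset_rfl (fun k hk => ((w.mem_root k).1 hk).1)
    (fun u k _ hk => (w.par_mem u k hk).2) (A.bit z)
    (fun u k hu hk => absurd (w.par_mem u k hk).1 hu)]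
  have h1 : ∀ j ∈ w.act, A.charge e j = A.ringBit (A.ring z) j := fun j hj =>
    A.charge_eq_ringBit fun i hi => by
      have := h.1 i (hring j hj i hi)
      rwa [Frame.ringRhs, hi, if_pos (hring j hj)] at this
  have h2 := w.sum_lin_add_ringSum h1
  have h3 : ∀ k, (if k ∈ w.H then A.bit z k + w.parSum (A.bit z) k else 0) =
      (if k ∈ w.H then w.lin e k + w.ringSum (A.ring z) k else 0) + A.noiseVec e k := by
    intro k
    by_cases hk : k ∈ w.H
    · simp only [if_pos hk]
      rw [h.2 k (hH k hk), rhs, if_pos hk, Frame.noiseVec]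
      linear_combination CharTwo.add_self_eq_zero (w.parSum (A.bit z) k)
    · have : k ∉ insert A.base A.Tr := fun h =>
        hk (h.elim (fun h => h ▸ w.base_mem) fun h => w.tr_subset h)
      rw [if_neg hk, if_neg hk, Frame.noiseVec, if_neg this, add_zero]
  rw [Finset.sum_congr rfl fun k _ => h3 k, Finset.sum_add_distrib, h2, zero_add]

end Wiring

/-! ### Which changes of the bits neutral shifts can realise -/

theorem add_self_eq_zero_of_zmodTwo {K : Type*} (f : K → ZMod 2) : f + f = 0 :=
  funext fun _ => CharTwo.add_self_eq_zero _

namespace Wiring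

open scoped Classical

variable {V : Type u} {A : Frame V} (w : Wiring A)

/-- The effect of a change of the latent variables on the defects of the binary coordinates. -/
noncomputable def eff (δ : A.Lat → A.W) (k : A.K) : ZMod 2 :=
  if k ∈ w.H then w.lin δ k else A.coin δ k

theorem eff_add (δ δ' : A.Lat → A.W) (k : A.K) : w.eff (δ + δ') k = w.eff δ k + w.eff δ' k := by
  unfold eff
  split_ifs
  · exact w.lin_add δ δ' k
  · rfl

/-- The effects of the changes that do not affect the rings and the noise. -/
def effects : AddSubmonoid (A.K → ZMod 2) where
  carrier := {κ | ∃ δ, A.Neutral δ ∧ w.eff δ = κ}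
  zero_mem' := by
    refine ⟨0, A.neutral_zero, funext fun k => ?_⟩
    have := w.eff_add 0 0 k
    rw [add_zero] at this
    exact left_eq_add.1 this
  add_mem' := by
    rintro _ _ ⟨δ, h, rfl⟩ ⟨δ', h', rfl⟩
    exact ⟨δ + δ', h.add h', funext fun k => w.eff_add δ δ' k⟩

theorem lin_edgeShift {j : A.E} (hj : j ∈ w.act) (k : A.K) : w.lin (A.edgeShift j) k =
    (Pi.single (A.src j) 1 + Pi.single (A.tgt j) 1 : A.K → ZMod 2) k := by
  unfold lin
  rw [Finset.sum_eq_single j, if_pos hj, A.srcCoin_edgeShift_self, A.tgtCoin_edgeShift_self,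
    Pi.add_apply, Pi.single_apply, Pi.single_apply]
  · simp only [eq_comm]
  · intro j' _ hj'
    rw [A.srcCoin_edgeShift_of_ne hj', A.tgtCoin_edgeShift_of_ne hj']
    simp
  · exact fun h => (h (Finset.mem_univ j)).elim

theorem eff_edgeShift {j : A.E} (hj : j ∈ w.act) : w.eff (A.edgeShift j) =
    Pi.single (A.src j) 1 + Pi.single (A.tgt j) 1 := by
  funext k
  unfold eff
  split_ifs with hk
  · exact w.lin_edgeShift hj k
  · have h := w.act_mem j hj
    have h1 : k ≠ A.src j := fun e => hk (e ▸ h.1)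
    have h2 : k ≠ A.tgt j := fun e => hk (e ▸ h.2)
    simp [A.coin_edgeShift, h1, h2]

theorem eff_coinShift {k : A.K} (hk : k ∉ w.H) : w.eff (A.coinShift k) = Pi.single k 1 := by
  funext k'
  unfold eff
  split_ifs with hk'
  · have h1 : k' ≠ k := fun e => hk (e ▸ hk')
    rw [Pi.single_eq_of_ne h1]
    refine Finset.sum_eq_zero fun j _ => ?_
    have h2 : A.srcCoin (A.coinShift k) j = 0 := rfl
    have h3 : A.tgtCoin (A.coinShift k) j = 0 := rfl
    simp [h2, h3]
  · exact A.coin_coinShift k k'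

/-- Flipping the coins along a path of edges changes only the two ends, since the inner vertices are
changed twice. This is where bidirected connectedness enters. -/
theorem single_add_single_mem {k k' : A.K} (hk : k ∈ w.H) (hk1 : k ∉ A.Tr) (hk' : k' ∈ w.H)
    (hk1' : k' ∉ A.Tr) : (Pi.single k 1 + Pi.single k' 1 : A.K → ZMod 2) ∈ w.effects := by
  have hconn := w.connected k hk hk1 k' hk' hk1'
  clear hk' hk1'
  induction hconn with
  | refl =>
    rw [add_self_eq_zero_of_zmodTwo]
    exact zero_mem _
  | @tail p q _ h ih =>
    obtain ⟨j, hj, h⟩ := h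
    have h1 : (Pi.single p 1 + Pi.single q 1 : A.K → ZMod 2) ∈ w.effects := by
      refine ⟨A.edgeShift j, A.neutral_edgeShift j, ?_⟩
      rw [w.eff_edgeShift hj]
      rcases h with ⟨rfl, rfl⟩ | ⟨rfl, rfl⟩
      · rfl
      · exact add_comm _ _
    have h2 := add_mem ih h1
    have h3 : (Pi.single k 1 + Pi.single p 1 + (Pi.single p 1 + Pi.single q 1) : A.K → ZMod 2) =
        Pi.single k 1 + Pi.single q 1 := by
      rw [add_assoc, ← add_assoc (Pi.single p 1), add_self_eq_zero_of_zmodTwo,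
        zero_add]
    rwa [h3] at h2

/-- Outside the forest private coins realise any change. Inside it, each change is paired with one
at `base`, and the corrections at `base` cancel because their sum is zero. -/
theorem mem_effects {κ : A.K → ZMod 2} (hTr : ∀ k ∈ A.Tr, κ k = 0)
    (hsum : (∑ k, if k ∈ w.H then κ k else 0) = 0) : κ ∈ w.effects := by
  have h1 : κ = ∑ k, (Pi.single k (κ k) + if k ∈ w.H then Pi.single A.base (κ k) else 0) := by
    rw [Finset.sum_add_distrib, Finset.univ_sum_single]
    have : ∀ k, (if k ∈ w.H then (Pi.single A.base (κ k) : A.K → ZMod 2) else 0) =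
        Pi.single A.base (if k ∈ w.H then κ k else 0) := fun k => by split_ifs <;> simp
    have h2 := map_sum (AddMonoidHom.single (fun _ : A.K => ZMod 2) A.base)
      (fun k => if k ∈ w.H then κ k else 0) Finset.univ
    rw [hsum, map_zero] at h2
    rw [Finset.sum_congr rfl fun k _ => this k]
    exact (add_eq_left.2 h2.symm).symm
  rw [h1]
  refine sum_mem fun k _ => ?_
  have h01 : κ k = 0 ∨ κ k = 1 := by
    generalize κ k = x
    revert x
    decide
  rcases h01 with h | h
  · rw [h]
    simp
  · have hk : k ∉ A.Tr := fun hk => by simp [hTr k hk] at h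
    rw [h]
    split_ifs with hkH
    · exact w.single_add_single_mem hkH hk w.base_mem A.base_notMem
    · rw [add_zero]
      exact ⟨_, A.neutral_coinShift k, w.eff_coinShift hkH⟩

/-- The defects of the binary coordinates. -/
noncomputable def defect (b : A.K → ZMod 2) (k : A.K) : ZMod 2 :=
  if k ∈ w.H then b k + w.parSum b k else b k

/-- The equations of the bits are affine, and a neutral shift leaves rings and noise alone. Only the
variables in `S` are tested, so this serves both the observational and the intervened system. -/
theorem sat_shift {S : Set V} {e δ : A.Lat → A.W} {z : ∀ v, A.Dom v} (h : w.Sat S e z)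
    (hδ : A.Neutral δ) {c : A.K → ZMod 2}
    (hc : ∀ k, A.owner k ∈ S → w.defect c k = w.eff δ k) :
    w.Sat S (e + δ) (A.assign (A.ring z) (A.bit z + c)) := by
  refine ⟨fun i hi => ?_, fun k hk => ?_⟩
  · rw [A.ring_assign, hδ.ringRhs_add]
    exact h.1 i hi
  · have h1 := h.2 k hk
    have h2 := hc k hk
    rw [A.ring_assign, A.bit_assign, Pi.add_apply, h1]
    unfold rhs
    unfold defect eff at h2
    split_ifs at h2 ⊢ with hkH hN
    all_goals first | rw [w.parSum_add, w.lin_add] | skip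
    · rw [hδ.noise_add]
      linear_combination h2 - CharTwo.add_self_eq_zero (w.parSum c k)
    · linear_combination h2 - CharTwo.add_self_eq_zero (w.parSum c k)
    · rw [h2]
      rfl

theorem defect_add (b b' : A.K → ZMod 2) (k : A.K) :
    w.defect (b + b') k = w.defect b k + w.defect b' k := by
  unfold defect
  split_ifs
  · rw [w.parSum_add, Pi.add_apply]
    ring
  · rfl

theorem trNoise_eq (b : A.K → ZMod 2) (k : A.K) (hk : k ∈ A.Tr) : A.trNoise b k = w.defect b k := by
  rw [Frame.trNoise, if_pos hk, defect, if_pos (w.tr_subset hk)]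
  simp only [parSum, w.par_tr _ k hk]

theorem sum_defect_eq (b : A.K → ZMod 2) :
    (∑ k, if k ∈ w.H then w.defect b k else 0) = A.rootSum b := by
  rw [← w.sum_defect w.H subset_rfl (fun k hk => ((w.mem_root k).1 hk).1)
    (fun u k _ hk => (w.par_mem u k hk).2) b (fun u k hu hk => absurd (w.par_mem u k hk).1 hu)]
  refine Finset.sum_congr rfl fun k _ => ?_
  unfold defect
  split_ifs <;> rfl

end Wiring

namespace Frame

variable {V : Type u} {A : Frame V}

open scoped Classical in
theorem rootSum_add (b b' : A.K → ZMod 2) :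
    A.rootSum (b + b') = A.rootSum b + A.rootSum b' := by
  unfold rootSum
  rw [← Finset.sum_add_distrib]
  refine Finset.sum_congr rfl fun k _ => ?_
  split_ifs <;> simp

/-- Since `trNoise` vanishes at `base`, the entry there only encodes the root sum. -/
theorem obsNoise_eq_iff {b b' : A.K → ZMod 2} : A.obsNoise b = A.obsNoise b' ↔
    A.trNoise b = A.trNoise b' ∧ A.rootSum b = A.rootSum b' := by
  constructor
  · intro h
    have h1 : A.trNoise b = A.trNoise b' := by
      funext k
      by_cases hk : k = A.base
      · subst hk
        rw [trNoise, trNoise, if_neg A.base_notMem, if_neg A.base_notMem]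
      · have := congrFun h k
        rwa [obsNoise, obsNoise, if_neg hk, if_neg hk] at this
    refine ⟨h1, ?_⟩
    have := congrFun h A.base
    rw [obsNoise, obsNoise, if_pos rfl, if_pos rfl, h1] at this
    exact add_right_cancel this
  · rintro ⟨h1, h2⟩
    funext k
    rw [obsNoise, obsNoise, h1, h2]

end Frame

/-! ### The observational distribution -/

namespace Wiring

open scoped Classical

variable {V : Type u} {A : Frame V} (w : Wiring A)

/-- The values of the latent variables at which `z` is the solution. -/
def fiber (z : ∀ v, A.Dom v) : Set (A.Lat → A.W) := {e | w.Sat Set.univ e z}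

/-- Equal observed noise means that the defects of `b + b'` vanish on `Tr` and have sum zero over
the forest, so a neutral shift realises them; translation by it injects one fiber into the other. -/
theorem ncard_fiber_le {r : A.I → A.T} {b b' : A.K → ZMod 2} (h : A.obsNoise b = A.obsNoise b') :
    (w.fiber (A.assign r b)).ncard ≤ (w.fiber (A.assign r b')).ncard := by
  obtain ⟨h1, h2⟩ := Frame.obsNoise_eq_iff.1 h
  have hb : b + (b + b') = b' := by
    rw [← add_assoc, add_self_eq_zero_of_zmodTwo, zero_add]
  have hmem : w.defect (b + b') ∈ w.effects := by
    refine w.mem_effects (fun k hk => ?_) ?_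
    · rw [w.defect_add, ← w.trNoise_eq b k hk, ← w.trNoise_eq b' k hk, h1]
      exact CharTwo.add_self_eq_zero _
    · rw [w.sum_defect_eq, Frame.rootSum_add, h2]
      exact CharTwo.add_self_eq_zero _
  obtain ⟨δ, hδ, hκ⟩ := hmem
  refine Set.ncard_le_ncard_of_injOn (· + δ) (fun e he => ?_) (add_left_injective δ).injOn
  have := w.sat_shift he hδ (c := b + b') fun k _ => (congrFun hκ k).symm
  rwa [A.ring_assign, A.bit_assign, hb] at this

theorem ncard_fiber_eq {r : A.I → A.T} {b b' : A.K → ZMod 2} (h : A.obsNoise b = A.obsNoise b') :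
    (w.fiber (A.assign r b)).ncard = (w.fiber (A.assign r b')).ncard :=
  (w.ncard_fiber_le h).antisymm (w.ncard_fiber_le h.symm)

theorem ring_eq_selected {e : A.Lat → A.W} {z : ∀ v, A.Dom v} (h : w.Sat Set.univ e z) :
    A.ring z = A.selected e := by
  funext i
  have := h.1 i trivial
  have hf : A.Full Set.univ (A.lab i) := fun _ _ => trivial
  rwa [Frame.ringRhs, if_pos hf] at this

/-- No edge in use touches a transport coordinate, so there the defect is the noise. The root sum is
the total noise, and subtracting the transport noise leaves that of `base`. -/
theorem obsNoise_eq {e : A.Lat → A.W} {z : ∀ v, A.Dom v} (h : w.Sat Set.univ e z) :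
    A.obsNoise (A.bit z) = A.noiseVec e := by
  have h0 := w.rootSum_eq h (fun _ _ => trivial) fun _ _ _ _ => trivial
  have hpull : ∀ k ∈ A.Tr, w.lin e k + w.ringSum (A.ring z) k = 0 := by
    intro k hk
    unfold lin ringSum
    rw [← Finset.sum_add_distrib]
    refine Finset.sum_eq_zero fun j _ => ?_
    by_cases hj : j ∈ w.act
    · have h := w.act_notMem j hj
      have h1 : A.src j ≠ k := fun e => h.1 (e ▸ hk)
      have h2 : A.tgt j ≠ k := fun e => h.2 (e ▸ hk)
      simp [h1, h2]
    · simp [hj]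
  have h1 : ∀ k, A.trNoise (A.bit z) k = if k ∈ A.Tr then A.noiseVec e k else 0 := by
    intro k
    by_cases hk : k ∈ A.Tr
    · have hkH := w.tr_subset hk
      rw [if_pos hk, w.trNoise_eq _ k hk, defect, if_pos hkH, h.2 k trivial, rhs, if_pos hkH,
        Frame.noiseVec, hpull k hk]
      linear_combination CharTwo.add_self_eq_zero (w.parSum (A.bit z) k)
    · rw [if_neg hk, Frame.trNoise, if_neg hk]
  funext k
  unfold Frame.obsNoise
  split_ifs with hk
  · subst hk
    rw [h0, ← Finset.sum_add_distrib, Finset.sum_eq_single A.base, h1, if_neg A.base_notMem,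
      add_zero]
    · intro k _ hk
      rw [h1]
      split_ifs with hkT
      · exact CharTwo.add_self_eq_zero _
      · rw [Frame.noiseVec, if_neg fun h => h.elim hk hkT, add_zero]
    · exact fun h => (h (Finset.mem_univ _)).elim
  · rw [h1]
    split_ifs with hkT
    · rfl
    · rw [Frame.noiseVec, if_neg fun h => h.elim hk hkT]

end Wiring

theorem Set.ncard_setOf_comp_eq_sum {α β : Type*} [Finite α] [Fintype β] (f : α → β)
    (p : β → Prop) [DecidablePred p] :
    {a | p (f a)}.ncard = ∑ b with p b, {a | f a = b}.ncard := by
  classical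
  have := Fintype.ofFinite α
  simp only [Set.ncard_eq_toFinset_card', Set.toFinset_ofPred]
  rw [Finset.card_eq_sum_card_fiberwise (f := f) (t := {b | p b}) fun a ha => by simpa using ha]
  refine Finset.sum_congr rfl fun b hb => congrArg _ ?_
  ext a
  simp only [Finset.mem_filter, Finset.mem_univ, true_and] at hb ⊢
  exact ⟨fun h => h.2, fun h => ⟨h ▸ hb, h⟩⟩

theorem Set.ncard_setOf_comp_congr {α α' β : Type*} [Finite α] [Finite α'] [Finite β] {f : α → β}
    {f' : α' → β} (h : ∀ b, {a | f a = b}.ncard = {a | f' a = b}.ncard) (p : β → Prop) :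
    {a | p (f a)}.ncard = {a | p (f' a)}.ncard := by
  classical
  have := Fintype.ofFinite β
  rw [Set.ncard_setOf_comp_eq_sum, Set.ncard_setOf_comp_eq_sum]
  exact Finset.sum_congr rfl fun b _ => h b

theorem AddMonoidHom.ncard_preimage_mul_card {G H : Type*} [AddGroup G] [AddGroup H] [Finite G]
    [Finite H] (f : G →+ H) (hf : Function.Surjective f) (p : H → Prop) :
    {g | p (f g)}.ncard * Nat.card H = {h | p h}.ncard * Nat.card G := by
  classical
  have := Fintype.ofFinite H
  have := Fintype.ofFinite G
  have hc : ∀ h, {g | f g = h}.ncard = {g | f g = 0}.ncard := fun h => by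
    simp only [Set.ncard_eq_toFinset_card', Set.toFinset_ofPred]
    exact AddMonoidHom.card_fiber_eq_of_mem_range f (hf h) (hf 0)
  have key : ∀ p : H → Prop, {g | p (f g)}.ncard = {h | p h}.ncard * {g | f g = 0}.ncard := by
    intro p
    rw [Set.ncard_setOf_comp_eq_sum, Finset.sum_congr rfl fun h _ => hc h, Finset.sum_const,
      smul_eq_mul]
    simp only [Set.ncard_eq_toFinset_card', Set.toFinset_ofPred]
  have h1 := key fun _ => True
  have h2 := key p
  simp only [Set.ofPred_true, Set.ncard_univ] at h1
  rw [h1, h2]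
  ring

namespace Frame

variable {V : Type u} {A : Frame V}

/-- This is positivity: every ring assignment and every observed noise occurs. -/
theorem exists_selected_noiseVec (r : A.I → A.T) (b : A.K → ZMod 2) :
    ∃ e : A.Lat → A.W, A.selected e = r ∧ A.noiseVec e = A.obsNoise b := by
  classical
  -- The exceptional values lie on `r` itself, so that `sel` returns `r`; the source coin alone
  -- supplies the parity. Noise is 1 exactly when the ternary value is 0, which explains the
  -- reversed last entry.
  let e : A.Lat → A.W := fun l => (fun i => r (A.prev i), r,
    fun j => if l = A.srcLat j then A.ringBit r j else 0, 0,
    fun k => if A.obsNoise b k = 0 then 1 else 0)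
  refine ⟨e, ?_, ?_⟩
  · have hcharge : ∀ j, A.charge e j = A.ringBit r j := by
      intro j
      have h1 : A.srcCoin e j = A.ringBit r j := if_pos rfl
      have h2 : A.tgtCoin e j = if A.tgtLat j = A.srcLat j then A.ringBit r j else 0 := rfl
      rw [charge, h1, h2]
      cases hp : A.pos j with
      | none => simp [ringBit, hp]
      | some i => rw [if_neg (A.lat_ne j i hp).symm, add_zero]
    funext i
    refine A.sel_self _ _ _ _ _ (fun _ _ => rfl) fun i' hi' => ?_
    rw [hcharge, ringBit, hi']
    rfl
  · funext k
    unfold noiseVec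
    split_ifs with hk
    · have h01 : ∀ x : ZMod 2, x = 0 ∨ x = 1 := by decide
      have h1 : A.rawNoise e k = if A.obsNoise b k = 0 then 1 else 0 := rfl
      rw [noise, h1]
      rcases h01 (A.obsNoise b k) with h | h <;> rw [h] <;> rfl
    · rw [obsNoise, trNoise, if_neg fun h => hk (.inl h), if_neg fun h => hk (.inr h)]

/-- The event depends only on uniform ternary values, and half of `3 ^ card K` is not an integer. -/
theorem two_mul_ncard_noise_ne :
    2 * ({e | ∑ k, A.noiseVec e k = 0} : Set (A.Lat → A.W)).ncard ≠ Nat.card (A.Lat → A.W) := by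
  classical
  intro h
  let f : (A.Lat → A.W) →+ (A.K → ZMod 3) :=
    { toFun := A.rawNoise, map_zero' := rfl, map_add' := fun _ _ => rfl }
  have hf : Function.Surjective f := fun y => ⟨fun _ => (0, 0, 0, 0, y), rfl⟩
  have key := f.ncard_preimage_mul_card hf fun y =>
    ∑ k, (if k ∈ insert A.base A.Tr then if y k = 0 then (1 : ZMod 2) else 0 else 0) = 0
  have h2 : ({e | ∑ k, A.noiseVec e k = 0} : Set (A.Lat → A.W)) = {e | ∑ k,
    (if k ∈ insert A.base A.Tr then if f e k = 0 then (1 : ZMod 2) else 0 else 0) = 0} := rfl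
  rw [← h2, ← h] at key
  have hpos : 0 < ({e | ∑ k, A.noiseVec e k = 0} : Set (A.Lat → A.W)).ncard := by
    have : 0 < Nat.card (A.Lat → A.W) := Nat.card_pos
    omega
  have h3 : Nat.card (A.K → ZMod 3) = 3 ^ Fintype.card A.K := by simp
  rw [h3, ← mul_assoc, mul_comm, mul_comm _ 2] at key
  have h4 := Nat.eq_of_mul_eq_mul_right hpos key
  have h5 : Odd (3 ^ Fintype.card A.K) := Odd.pow (by decide)
  rw [h4] at h5
  exact (Nat.not_odd_iff_even.2 (even_two_mul _)) h5

end Frame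

namespace Wiring

open scoped Classical

variable {V : Type u} {A : Frame V} (w : Wiring A)

/-- The solution of the equations of the variables in `S`, for given values of the others. -/
noncomputable def solution (S : Set V) (e : A.Lat → A.W) (x : ∀ v, A.Dom v) : ∀ v, A.Dom v :=
  (w.existsUnique_sat S e x).choose

theorem solution_off (S : Set V) (e : A.Lat → A.W) (x : ∀ v, A.Dom v) {v : V} (hv : v ∉ S) :
    w.solution S e x v = x v :=
  (w.existsUnique_sat S e x).choose_spec.1.1 v hv

theorem sat_solution (S : Set V) (e : A.Lat → A.W) (x : ∀ v, A.Dom v) :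
    w.Sat S e (w.solution S e x) :=
  (w.existsUnique_sat S e x).choose_spec.1.2

theorem eq_solution {S : Set V} {e : A.Lat → A.W} {x z : ∀ v, A.Dom v}
    (h1 : ∀ v, v ∉ S → z v = x v) (h2 : w.Sat S e z) : z = w.solution S e x :=
  (w.existsUnique_sat S e x).choose_spec.2 z ⟨h1, h2⟩

theorem eq_solution_univ {e : A.Lat → A.W} {x z : ∀ v, A.Dom v} (h : w.Sat Set.univ e z) :
    z = w.solution Set.univ e x :=
  w.eq_solution (fun _ hv => (hv trivial).elim) h

/-- The latent values on the right split into the fibers over all `b'` with the observed noise of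
`b`, and these fibers are equally large. Neither the right-hand side nor the number of fibers
involves the wiring. -/
theorem ncard_mul_ncard_fiber (r : A.I → A.T) (b : A.K → ZMod 2) :
    {b' | A.obsNoise b' = A.obsNoise b}.ncard * (w.fiber (A.assign r b)).ncard =
      {e | A.selected e = r ∧ A.noiseVec e = A.obsNoise b}.ncard := by
  let f : (A.Lat → A.W) → (A.I → A.T) × (A.K → ZMod 2) := fun e =>
    (A.selected e, A.bit (w.solution Set.univ e 0))
  have h1 : {e | A.selected e = r ∧ A.noiseVec e = A.obsNoise b} =
      {e | (f e).1 = r ∧ A.obsNoise (f e).2 = A.obsNoise b} := by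
    ext e
    simp only [Set.mem_ofPred_eq, f, w.obsNoise_eq (w.sat_solution Set.univ e 0)]
  have h2 : ∀ r b, {e | f e = (r, b)} = w.fiber (A.assign r b) := by
    intro r b
    ext e
    have hs := w.sat_solution Set.univ e 0
    have hr := w.ring_eq_selected hs
    simp only [Set.mem_ofPred_eq, f, fiber, Prod.mk.injEq]
    constructor
    · rintro ⟨h1, h2⟩
      rwa [← h1, ← h2, ← hr, A.assign_ring_bit]
    · intro h
      rw [← w.eq_solution_univ h]
      exact ⟨(w.ring_eq_selected h).symm, rfl⟩
  rw [h1, Set.ncard_setOf_comp_eq_sum f fun q => q.1 = r ∧ A.obsNoise q.2 = A.obsNoise b]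
  have h3 : ∀ q ∈ ({q : (A.I → A.T) × (A.K → ZMod 2) | q.1 = r ∧ A.obsNoise q.2 = A.obsNoise b} :
      Finset _), {e | f e = q}.ncard = (w.fiber (A.assign r b)).ncard := by
    rintro ⟨r', b'⟩ hq
    simp only [Finset.mem_filter, Finset.mem_univ, true_and] at hq
    rw [h2, hq.1, w.ncard_fiber_eq hq.2]
  rw [Finset.sum_congr rfl h3, Finset.sum_const, smul_eq_mul]
  congr 1
  rw [Set.ncard_eq_toFinset_card', ← Finset.card_map ⟨fun b' => (r, b'), Prod.mk_right_injective r⟩]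
  congr 1
  ext ⟨r', b'⟩
  simp only [Finset.mem_map, Set.mem_toFinset, Set.mem_ofPred_eq, Function.Embedding.coeFn_mk,
    Prod.mk.injEq, Finset.mem_filter, Finset.mem_univ, true_and]
  constructor
  · rintro ⟨b'', h, rfl, rfl⟩
    exact ⟨rfl, h⟩
  · rintro ⟨rfl, h⟩
    exact ⟨b', h, rfl, rfl⟩

theorem ncard_obsNoise_pos (b : A.K → ZMod 2) : 0 < {b' | A.obsNoise b' = A.obsNoise b}.ncard :=
  (Set.ncard_pos (Set.toFinite _)).2 ⟨b, rfl⟩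

/-- The observational distribution does not depend on the wiring. -/
theorem ncard_fiber_wiring (w w' : Wiring A) (z : ∀ v, A.Dom v) :
    (w.fiber z).ncard = (w'.fiber z).ncard := by
  rw [← A.assign_ring_bit z]
  refine Nat.eq_of_mul_eq_mul_left (ncard_obsNoise_pos (A.bit z)) ?_
  rw [ncard_mul_ncard_fiber, ncard_mul_ncard_fiber]

theorem ncard_fiber_pos (z : ∀ v, A.Dom v) : 0 < (w.fiber z).ncard := by
  rw [← A.assign_ring_bit z]
  refine pos_of_mul_pos_right (a := {b' | A.obsNoise b' = A.obsNoise (A.bit z)}.ncard) ?_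
    (Nat.zero_le _)
  rw [ncard_mul_ncard_fiber]
  exact (Set.ncard_pos (Set.toFinite _)).2 (A.exists_selected_noiseVec (A.ring z) (A.bit z))

/-! ### The interventional distributions -/

/-- The total noise decides the parity of the roots under an intervention that misses the forest
and the rings in use. -/
theorem two_mul_ncard_rootSum_ne {X : Set V} (hH : ∀ k ∈ w.H, A.owner k ∉ X)
    (hring : ∀ j ∈ w.act, A.Full Xᶜ j) (x : ∀ v, A.Dom v) :
    2 * {e | A.rootSum (A.bit (w.solution Xᶜ e x)) = 0}.ncard ≠ Nat.card (A.Lat → A.W) := by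
  simp only [w.rootSum_eq (w.sat_solution Xᶜ _ x) hH hring]
  exact A.two_mul_ncard_noise_ne

/-- Propagates a change of the defects down the forest, with the bits outside `S` held fixed. -/
theorem exists_response (S : Set V) (κ : A.K → ZMod 2) : ∃ c : A.K → ZMod 2,
    (∀ k, A.owner k ∉ S → c k = 0) ∧ ∀ k, A.owner k ∈ S → w.defect c k = κ k := by
  obtain ⟨c, hc, -⟩ := w.par_wf.existsUnique_forall_eq (fun k (c : A.K → ZMod 2) =>
    if A.owner k ∈ S then if k ∈ w.H then κ k + w.parSum c k else κ k else 0) (by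
      intro k y y' h
      rw [w.parSum_congr h])
  refine ⟨c, fun k hk => by rw [hc k, if_neg hk], fun k hk => ?_⟩
  have h := hc k
  rw [if_pos hk] at h
  unfold defect
  split_ifs at h ⊢
  · rw [h, add_assoc, CharTwo.add_self_eq_zero, add_zero]
  · exact h

theorem exists_crossing {B : Set A.K} {k k' : A.K} (hk : k ∈ B) (hk' : k' ∉ B)
    (h : ReflTransGen
      (fun p q => ∃ j ∈ w.act, A.src j = p ∧ A.tgt j = q ∨ A.src j = q ∧ A.tgt j = p) k k') :
    ∃ j ∈ w.act, A.src j ∈ B ∧ A.tgt j ∉ B ∨ A.src j ∉ B ∧ A.tgt j ∈ B := by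
  induction h with
  | refl => exact absurd hk hk'
  | @tail p q _ h ih =>
    by_cases hp : p ∈ B
    · obtain ⟨j, hj, ⟨rfl, rfl⟩ | ⟨rfl, rfl⟩⟩ := h
      · exact ⟨j, hj, .inl ⟨hp, hk'⟩⟩
      · exact ⟨j, hj, .inr ⟨hk', hp⟩⟩
    · exact ih hp

/-- The parity of the roots is uniform under an intervention that meets the forest, if it misses
the descendants of the base. -/
theorem two_mul_ncard_rootSum_eq {X : Set V}
    (hbase : ∀ k, ReflTransGen w.par A.base k → A.owner k ∉ X) (hroot : ∀ k ∈ A.root, A.owner k ∉ X)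
    (hX : ∃ k ∈ w.H, k ∉ A.Tr ∧ A.owner k ∈ X) (x : ∀ v, A.Dom v) :
    2 * {e | A.rootSum (A.bit (w.solution Xᶜ e x)) = 0}.ncard = Nat.card (A.Lat → A.W) := by
  -- `B` consists of the forest coordinates whose way to the roots survives the intervention. It
  -- contains `base` but not `k₀`, so some edge in use crosses its boundary.
  obtain ⟨B, hB⟩ : ∃ B : Set A.K, ∀ k, k ∈ B ↔
      k ∈ w.H ∧ ∀ k', ReflTransGen w.par k k' → A.owner k' ∉ X := ⟨{k | _}, fun _ => Iff.rfl⟩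
  have hBX : ∀ k ∈ B, A.owner k ∉ X := fun k hk => ((hB k).1 hk).2 k .refl
  obtain ⟨k₀, hk₀, hk₀T, hk₀X⟩ := hX
  obtain ⟨j, hj, hcross⟩ := w.exists_crossing (B := B) ((hB _).2 ⟨w.base_mem, hbase⟩)
    (fun h => hBX k₀ h hk₀X) (w.connected _ w.base_mem A.base_notMem k₀ hk₀ hk₀T)
  obtain ⟨c, hc1, hc2⟩ := w.exists_response Xᶜ (w.eff (A.edgeShift j))
  have hroots : A.root ⊆ B := by
    intro k hk
    refine (hB k).2 ⟨((w.mem_root k).1 hk).1, fun k' h => ?_⟩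
    rcases ReflTransGen.cases_head h with h | ⟨k'', h, -⟩
    · exact h ▸ hroot k hk
    · exact absurd h (((w.mem_root k).1 hk).2 k'')
  have hsum : A.rootSum c = 1 := by
    rw [← w.sum_defect B (fun k hk => ((hB k).1 hk).1) hroots (fun u k hu h =>
      (hB k).2 ⟨(w.par_mem u k h).2, fun k' h' => ((hB u).1 hu).2 k' (.head h h')⟩) c ?_]
    · have h1 : ∀ k, (if k ∈ B then c k + w.parSum c k else 0) =
          if k ∈ B then w.lin (A.edgeShift j) k else 0 := by
        intro k
        by_cases hk : k ∈ B
        · have := hc2 k (hBX k hk)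
          rw [defect, eff, if_pos ((hB k).1 hk).1, if_pos ((hB k).1 hk).1] at this
          rw [if_pos hk, if_pos hk, this]
        · rw [if_neg hk, if_neg hk]
      -- Exactly one end of the crossing edge lies in `B`, so exactly one of the two flipped coins
      -- reaches the roots.
      rw [Finset.sum_congr rfl fun k _ => h1 k, w.sum_lin, Finset.sum_eq_single j, if_pos hj,
        A.srcCoin_edgeShift_self, A.tgtCoin_edgeShift_self]
      · rcases hcross with ⟨h1, h2⟩ | ⟨h1, h2⟩ <;> simp [h1, h2]
      · intro j' _ hj'
        rw [A.srcCoin_edgeShift_of_ne hj', A.tgtCoin_edgeShift_of_ne hj']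
        simp
      · exact fun h => (h (Finset.mem_univ j)).elim
    · intro u k hu h hk
      -- The only child of `u` is in `B`, so `u` can fail to be in `B` only by being intervened on,
      -- and then its bit does not respond.
      refine hc1 u fun huX => hu ((hB u).2 ⟨(w.par_mem u k h).1, fun k' h' => ?_⟩)
      rcases ReflTransGen.cases_head h' with h' | ⟨k'', h1, h2⟩
      · exact h' ▸ huX
      · exact ((hB k).1 hk).2 k' (w.par_unique u k'' k h1 h ▸ h2)
  have hflip : ∀ e, A.rootSum (A.bit (w.solution Xᶜ (e + A.edgeShift j) x)) =
      A.rootSum (A.bit (w.solution Xᶜ e x)) + 1 := by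
    intro e
    have h1 := w.sat_shift (w.sat_solution Xᶜ e x) (A.neutral_edgeShift j) hc2
    rw [← w.eq_solution (x := x) ?_ h1, A.bit_assign, Frame.rootSum_add, hsum]
    have h2 := (A.eq_on_iff X (A.assign (A.ring (w.solution Xᶜ e x))
      (A.bit (w.solution Xᶜ e x) + c)) (w.solution Xᶜ e x)).2
      ⟨fun _ _ => rfl, fun k hk => by
        rw [A.bit_assign, Pi.add_apply, hc1 k fun h => h hk, add_zero]⟩
    intro v hv
    rw [h2 v (not_not.1 hv), w.solution_off _ _ _ hv]
  have h01 : ∀ y : ZMod 2, y + 1 = 0 ↔ y ≠ 0 := by decide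
  -- Translation by the edge shift exchanges the two parities.
  have h1 : ({e | A.rootSum (A.bit (w.solution Xᶜ e x)) = 0} : Set (A.Lat → A.W)).ncard =
      ({e | A.rootSum (A.bit (w.solution Xᶜ e x)) = 0}ᶜ : Set (A.Lat → A.W)).ncard := by
    rw [← Set.ncard_image_of_injective ({e | _}ᶜ : Set (A.Lat → A.W))
      (add_left_injective (A.edgeShift j))]
    congr 1
    ext e
    simp only [Set.mem_ofPred_eq, Set.mem_image, Set.mem_compl_iff]
    have hee : ∀ e : A.Lat → A.W, e - A.edgeShift j + A.edgeShift j = e := fun e =>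
      sub_add_cancel _ _
    constructor
    · intro h
      refine ⟨e - A.edgeShift j, ?_, hee e⟩
      have := hflip (e - A.edgeShift j)
      rw [hee, h] at this
      exact (h01 _).1 this.symm
    · rintro ⟨e', h, rfl⟩
      rw [hflip]
      exact (h01 _).2 h
  have h2 := Set.ncard_add_ncard_compl
    ({e | A.rootSum (A.bit (w.solution Xᶜ e x)) = 0} : Set (A.Lat → A.W))
  rw [← h1] at h2
  omega

/-! ### From counting latent values to probabilities -/

/-- The system of equations of a wiring. -/
noncomputable def system : EqSystem V A.Dom where
  Lat := A.Lat
  W := A.W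
  dir := A.dir
  lat := A.lat
  dir_irrefl := A.dir_irrefl
  exists_lat v := ⟨_, A.lat_own v⟩
  Sat := w.Sat
  existsUnique_sat := w.existsUnique_sat
  sat_mono := w.sat_mono
  sat_local := w.sat_local

section

variable [Finite V] [∀ v, MeasurableSpace (A.Dom v)] [∀ v, DiscreteMeasurableSpace (A.Dom v)]

theorem prob_pos (x z : ∀ v, A.Dom v) : 0 < w.system.toIOSCM.prob x {z} := by
  rw [EqSystem.prob_singleton]
  exact ENNReal.mul_pos w.system.weight_ne_zero (Nat.cast_ne_zero.2 (w.ncard_fiber_pos z).ne')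

theorem prob_eq (w w' : Wiring A) (x z : ∀ v, A.Dom v) :
    w.system.toIOSCM.prob x {z} = w'.system.toIOSCM.prob x {z} := by
  rw [EqSystem.prob_singleton, EqSystem.prob_singleton]
  exact congrArg (fun n : ℕ => w.system.weight * n) (ncard_fiber_wiring w w' z)

theorem doProb_eq (X : Set V) (x : ∀ v, A.Dom v) (B : Set (∀ v, A.Dom v)) :
    w.system.toIOSCM.doProb X x B =
      w.system.weight * ({e | w.solution Xᶜ e x ∈ B} : Set (A.Lat → A.W)).ncard := by
  rw [EqSystem.doProb_eq]
  congr 3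
  ext e
  constructor
  · rintro ⟨z, ⟨h1, h2⟩, h3⟩
    rwa [w.eq_solution (x := x) (fun v hv => h1 v (not_not.1 hv)) h2] at h3
  · exact fun h => ⟨_, ⟨fun v hv => w.solution_off Xᶜ e x (not_not.2 hv), w.sat_solution _ _ _⟩, h⟩

/-- Equal effects on `Y` would give equal counts for even root sum, as the roots lie in `Y`. But `w`
is cut by `X` and gives exactly one half, while `w'` is intact and cannot. -/
theorem exists_doProb_ne {w w' : Wiring A} {X Y : Set V}
    (hbase : ∀ k, ReflTransGen w.par A.base k → A.owner k ∉ X)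
    (hX : ∃ k ∈ w.H, k ∉ A.Tr ∧ A.owner k ∈ X) (hH : ∀ k ∈ w'.H, A.owner k ∉ X)
    (hring : ∀ j ∈ w'.act, A.Full Xᶜ j) (hY : ∀ k ∈ A.root, A.owner k ∈ Y) :
    ¬ ∀ x y : ∀ v, A.Dom v, w.system.toIOSCM.doProb X x {v | ∀ a ∈ Y, v a = y a} =
      w'.system.toIOSCM.doProb X x {v | ∀ a ∈ Y, v a = y a} := by
  intro h
  have hroot : ∀ k ∈ A.root, A.owner k ∉ X := fun k hk => hH k ((w'.mem_root k).1 hk).1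
  -- Zeroing the variables outside `Y` gives a canonical representative of each event on `Y`, so
  -- that the counts of the events can be added up without repetition.
  let res : (∀ v, A.Dom v) → ∀ v, A.Dom v := fun z v => if v ∈ Y then z v else 0
  have hres : ∀ z, A.rootSum (A.bit (res z)) = A.rootSum (A.bit z) := by
    intro z
    refine Finset.sum_congr rfl fun k _ => ite_congr rfl (fun hk => ?_) fun _ => rfl
    simp only [Frame.bit, res, if_pos (hY k hk)]
  have hset : ∀ (w : Wiring A) (y : ∀ v, A.Dom v),
      {e | res (w.solution Xᶜ e 0) = y} = if res y = y then
        {e | w.solution Xᶜ e 0 ∈ {v | ∀ a ∈ Y, v a = y a}} else ∅ := by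
    intro w y
    ext e
    split_ifs with hy
    · simp only [Set.mem_ofPred_eq]
      constructor
      · rintro hy a ha
        rw [← hy]
        simp only [res, if_pos ha]
      · intro h
        rw [← hy]
        funext v
        simp only [res]
        exact ite_congr rfl (h v) fun _ => rfl
    · simp only [Set.mem_ofPred_eq, Set.mem_empty_iff_false, iff_false]
      rintro rfl
      refine hy (funext fun v => ?_)
      simp only [res]
      split_ifs <;> rfl
  have hcard : ∀ y : ∀ v, A.Dom v, {e | w.solution Xᶜ e 0 ∈ {v | ∀ a ∈ Y, v a = y a}}.ncard =
      {e | w'.solution Xᶜ e 0 ∈ {v | ∀ a ∈ Y, v a = y a}}.ncard := by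
    intro y
    have := h 0 y
    rw [doProb_eq, doProb_eq] at this
    exact Nat.cast_injective
      ((ENNReal.mul_right_inj w.system.weight_ne_zero w.system.weight_ne_top).1 this)
  have key := Set.ncard_setOf_comp_congr (f := fun e => res (w.solution Xᶜ e 0))
    (f' := fun e => res (w'.solution Xᶜ e 0)) (fun y => by
      rw [hset w, hset w']
      split_ifs
      · exact hcard y
      · rfl) fun z => A.rootSum (A.bit z) = 0
  simp only [hres] at key
  exact w'.two_mul_ncard_rootSum_ne hH hring 0
    (key ▸ w.two_mul_ncard_rootSum_eq hbase hroot hX 0)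

end

end Wiring

/-! ### Hedges whose rings avoid the intervention -/

/-- A map that sends steps between distinct points to steps sends paths to paths. -/
theorem Relation.ReflTransGen.map_of_ne {α β : Type*} {r : α → α → Prop} {s : β → β → Prop}
    (f : α → β) (h : ∀ a b, a ≠ b → r a b → s (f a) (f b)) {a b : α} (hab : ReflTransGen r a b) :
    ReflTransGen s (f a) (f b) := by
  induction hab with
  | refl => exact .refl
  | @tail b c _ h2 ih =>
    by_cases hbc : b = c
    · exact hbc ▸ ih
    · exact ih.tail (h b c hbc h2)

theorem Finite.wellFounded_of_transGen_irrefl {α : Type*} [Finite α] {r : α → α → Prop}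
    (h : ∀ a, ¬ TransGen r a a) : WellFounded r := by
  have : Std.Irrefl (TransGen r) := ⟨h⟩
  exact Subrelation.wf (r := TransGen r) (fun h => .single h)
    (Finite.wellFounded_of_trans_of_irrefl (TransGen r))

namespace MixedGraph

variable {N : Type*} {G : MixedGraph N}

theorem scc_eq_scc_iff {a b : N} :
    G.scc a = G.scc b ↔ ReflTransGen G.dir a b ∧ ReflTransGen G.dir b a := by
  have hmem : ∀ a b, a ∈ G.scc b ↔ ReflTransGen G.dir a b ∧ ReflTransGen G.dir b a := by
    intro a b
    simp [scc, ancestors, descendants]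
  constructor
  · intro h
    rw [← hmem, ← h, hmem]
    exact ⟨.refl, .refl⟩
  · rintro ⟨h1, h2⟩
    ext c
    rw [hmem, hmem]
    exact ⟨fun h => ⟨h.1.trans h1, h2.trans h.2⟩, fun h => ⟨h.1.trans h2, h1.trans h.2⟩⟩

theorem notMem_of_mem_ancestors {X Y : Set N} (hXY : Disjoint X Y) {a : N}
    (ha : a ∈ (G.deleteVerts X).ancestors Y) : a ∉ X := by
  obtain ⟨b, hb, h⟩ := ha
  rcases ReflTransGen.cases_head h with rfl | ⟨c, h, -⟩
  · exact fun h => Set.disjoint_left.1 hXY h hb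
  · exact h.1

theorem mem_ancestors_of_dir {X Y : Set N} {a b : N} (ha : a ∉ X) (hb : b ∉ X) (h : G.dir a b)
    (hY : b ∈ (G.deleteVerts X).ancestors Y) : a ∈ (G.deleteVerts X).ancestors Y :=
  hY.imp fun _ hc => ⟨hc.1, hc.2.head ⟨ha, hb, h⟩⟩

/-- Every vertex of a finite acyclic subgraph has a root as a descendant. -/
theorem Sub.exists_root [Finite N] {F : G.Sub} (hF : ∀ a, ¬ TransGen F.dir a a) {a : N}
    (ha : a ∈ F.verts) : ∃ r ∈ F.roots, ReflTransGen F.dir a r := by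
  have hwf : WellFounded (Function.swap F.dir) :=
    Finite.wellFounded_of_transGen_irrefl fun a h => hF a (transGen_swap.1 h)
  induction a using hwf.induction with
  | _ a ih =>
    by_cases h : ∃ b, F.dir a b
    · obtain ⟨b, hb⟩ := h
      obtain ⟨r, hr, hbr⟩ := ih b hb (F.dir_sub a b hb).2.1
      exact ⟨r, hr, hbr.head hb⟩
    · exact ⟨a, ⟨ha, fun b hb => h ⟨b, hb⟩⟩, .refl⟩

/-- Every vertex of the smaller forest of a hedge is an ancestor of `Y` in `G \ X`. -/
theorem IsHedge.verts_subset [Finite N] {X Y : Set N} {F F' : G.Sub} (h : G.IsHedge X Y F F') :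
    F'.verts ⊆ (G.deleteVerts X).ancestors Y := by
  obtain ⟨-, hF', R, -, hR, -, hX, -, hRY⟩ := h
  intro a ha
  have hnX : ∀ b ∈ F'.verts, b ∉ X := fun b hb hbX =>
    Set.eq_empty_iff_forall_notMem.1 hX b ⟨hbX, hb⟩
  obtain ⟨r, hr, har⟩ := F'.exists_root hF'.1 ha
  obtain ⟨y, hy, hry⟩ := hRY (hR ▸ hr)
  exact ⟨y, hy, (har.lift id fun p q hpq =>
    have := F'.dir_sub p q hpq
    ⟨hnX p this.1, hnX q this.2.1, this.2.2⟩).trans hry⟩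

/-- On a path from `X` to an ancestor of `Y` in `G \ X` there is a last edge that leaves `X`. -/
theorem exists_dir_of_path {X Y : Set N} {x a : N} (hxa : ReflTransGen G.dir x a) (hx : x ∈ X)
    (ha : a ∈ (G.deleteVerts X).ancestors Y) (haX : a ∉ X) :
    ∃ p ∈ X, ∃ d ∉ X, G.dir p d ∧ d ∈ (G.deleteVerts X).ancestors Y ∧ ReflTransGen G.dir x p ∧
      ReflTransGen G.dir d a := by
  have key : (x ∉ X ∧ x ∈ (G.deleteVerts X).ancestors Y) ∨
      ∃ p ∈ X, ∃ d ∉ X, G.dir p d ∧ d ∈ (G.deleteVerts X).ancestors Y ∧ ReflTransGen G.dir x p ∧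
        ReflTransGen G.dir d a := by
    clear hx
    induction hxa using ReflTransGen.head_induction_on with
    | refl => exact .inl ⟨haX, ha⟩
    | @head x y hxy hya ih =>
      rcases ih with ⟨hy, hyA⟩ | ⟨p, hp, d, hd, h1, h2, h3, h4⟩
      · by_cases hxX : x ∈ X
        · exact .inr ⟨x, hxX, y, hy, hxy, hyA, .refl, hya⟩
        · exact .inl ⟨hxX, mem_ancestors_of_dir hxX hy hxy hyA⟩
      · exact .inr ⟨p, hp, d, hd, h1, h2, h3.head hxy, h4⟩
  exact key.resolve_left fun h => h.1 hx

/-- The forest with one edge `p → d` between vertices with the same strongly connected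
component. -/
def edgeForest {p d : N} (h : G.dir p d) (hpd : p ≠ d) (hscc : G.scc p = G.scc d) :
    G.scProjection.Sub where
  verts := {p, d}
  dir a b := a = p ∧ b = d
  bi a b := a = p ∧ b = d ∨ a = d ∧ b = p
  bi_symm a b h := h.symm.imp And.symm And.symm
  dir_sub := by
    rintro _ _ ⟨rfl, rfl⟩
    exact ⟨.inl rfl, .inr rfl, h⟩
  bi_sub := by
    rintro _ _ (⟨rfl, rfl⟩ | ⟨rfl, rfl⟩)
    · exact ⟨.inl rfl, .inr rfl, .inr ⟨hpd, hscc⟩⟩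
    · exact ⟨.inr rfl, .inl rfl, .inr ⟨hpd.symm, hscc.symm⟩⟩

/-- The forest with one vertex. -/
def pointForest (G : MixedGraph N) (d : N) : G.Sub where
  verts := {d}
  dir _ _ := False
  bi _ _ := False
  bi_symm _ _ h := h
  dir_sub _ _ h := h.elim
  bi_sub _ _ h := h.elim

theorem isHedge_edgeForest {X Y : Set N} {p d : N} (h : G.dir p d) (hpd : p ≠ d)
    (hscc : G.scc p = G.scc d) (hp : p ∈ X) (hd : d ∉ X)
    (hdY : d ∈ (G.deleteVerts X).ancestors Y) :
    G.scProjection.IsHedge X Y (edgeForest h hpd hscc) (G.scProjection.pointForest d) := by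
  refine ⟨⟨?_, ?_, ?_⟩, ⟨?_, ?_, ?_⟩, {d}, ?_, ?_, ⟨p, hp, .inl rfl⟩, ?_, ⟨?_, ?_, ?_⟩, ?_⟩
  · intro a ha
    obtain ⟨b, h1, -⟩ := TransGen.head'_iff.1 ha
    obtain ⟨c, -, h2⟩ := TransGen.tail'_iff.1 ha
    exact hpd (h1.1.symm.trans h2.2)
  · rintro a b c ⟨-, rfl⟩ ⟨-, rfl⟩
    rfl
  · rintro a (rfl | rfl) b (rfl | rfl)
    · exact .refl
    · exact .single (.inl ⟨rfl, rfl⟩)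
    · exact .single (.inr ⟨rfl, rfl⟩)
    · exact .refl
  · intro a ha
    obtain ⟨b, h1, -⟩ := TransGen.head'_iff.1 ha
    exact h1
  · exact fun _ _ _ h => h.elim
  · rintro a rfl b rfl
    exact .refl
  · ext a
    constructor
    · rintro ⟨rfl | rfl, h2⟩
      · exact (h2 d ⟨rfl, rfl⟩).elim
      · rfl
    · rintro rfl
      exact ⟨.inr rfl, fun b hb => hpd hb.1.symm⟩
  · ext a
    exact ⟨fun h => h.1, fun h => ⟨h, fun _ hb => hb⟩⟩
  · ext a
    simp only [Set.mem_inter_iff, Set.mem_empty_iff_false, iff_false, not_and]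
    rintro ha rfl
    exact hd ha
  · exact fun a ha => .inr ha
  · exact fun _ _ h => h.elim
  · exact fun _ _ h => h.elim
  · rintro a rfl
    exact hdY

/-- An SC-hedge can be chosen such that the strongly connected components that are used by the
smaller forest avoid `X`. -/
theorem exists_safe_hedge [Finite N] {X Y : Set N} (hXY : Disjoint X Y) (h : G.HasSCHedge X Y) :
    ∃ F F' : G.scProjection.Sub, G.scProjection.IsHedge X Y F F' ∧
      ∀ a b, F'.bi a b → ¬ G.bi a b → ∀ c ∈ X, ReflTransGen G.dir a c → ¬ ReflTransGen G.dir c a := by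
  obtain ⟨F, F', hF⟩ := h
  by_contra! hcon
  obtain ⟨a, b, hab, -, x, hx, hax, hxa⟩ := hcon F F' hF
  have ha : a ∈ (G.deleteVerts X).ancestors Y := hF.verts_subset (F'.bi_sub a b hab).1
  obtain ⟨p, hp, d, hd, hpd, hdY, hxp, hda⟩ :=
    exists_dir_of_path hxa hx ha (notMem_of_mem_ancestors hXY ha)
  have hne : p ≠ d := fun h => hd (h ▸ hp)
  have hscc : G.scc p = G.scc d :=
    scc_eq_scc_iff.2 ⟨.single hpd, (hda.trans hax).trans hxp⟩
  -- The smaller forest of this new hedge is a single point without bidirected edges, so it cannot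
  -- violate the condition.
  obtain ⟨_, _, h, -⟩ := hcon _ _ (isHedge_edgeForest hpd hne hscc hp hd hdY)
  exact h

/-! ### Lifting the hedge from clusters to variables -/

section lift

variable {C : Type*} (G : MixedGraph C) (cl : N → C)

/-- The largest mixed graph with cluster graph `G`. -/
def expand : MixedGraph N where
  dir a b := a ≠ b ∧ G.dir (cl a) (cl b)
  bi a b := a ≠ b ∧ G.bi (cl a) (cl b)
  bi_symm _ _ h := ⟨h.1.symm, G.bi_symm _ _ h.2⟩

variable {G cl} {rep : C → N} (hrep : ∀ c, cl (rep c) = c)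

theorem rep_ne (hrep : ∀ c, cl (rep c) = c) {c d : C} (h : c ≠ d) : rep c ≠ rep d :=
  fun e => h (by rw [← hrep c, e, hrep d])

theorem reflTransGen_expand (hrep : ∀ c, cl (rep c) = c) {c d : C} (h : ReflTransGen G.dir c d) :
    ReflTransGen (G.expand cl).dir (rep c) (rep d) :=
  h.map_of_ne rep fun a b hab h => ⟨rep_ne hrep hab, by rwa [hrep, hrep]⟩

theorem rep_mem_ancestors (hrep : ∀ c, cl (rep c) = c) {X Y : Set C} {c : C}
    (h : c ∈ (G.deleteVerts X).ancestors Y) :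
    rep c ∈ ((G.expand cl).deleteVerts (cl ⁻¹' X)).ancestors (cl ⁻¹' Y) := by
  obtain ⟨y, hy, h⟩ := h
  refine ⟨rep y, by rwa [Set.mem_preimage, hrep], h.map_of_ne rep fun a b hab h => ?_⟩
  refine ⟨?_, ?_, rep_ne hrep hab, ?_⟩
  · rw [Set.mem_preimage, hrep]
    exact h.1
  · rw [Set.mem_preimage, hrep]
    exact h.2.1
  · rw [hrep, hrep]
    exact h.2.2

/-- The subgraph on the representatives of the clusters. -/
def Sub.lift (hrep : ∀ c, cl (rep c) = c) (F : G.scProjection.Sub) :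
    (G.expand cl).scProjection.Sub where
  verts := {a | rep (cl a) = a ∧ cl a ∈ F.verts}
  dir a b := rep (cl a) = a ∧ rep (cl b) = b ∧ a ≠ b ∧ F.dir (cl a) (cl b)
  bi a b := rep (cl a) = a ∧ rep (cl b) = b ∧ a ≠ b ∧ F.bi (cl a) (cl b)
  bi_symm a b h := ⟨h.2.1, h.1, h.2.2.1.symm, F.bi_symm _ _ h.2.2.2⟩
  dir_sub := by
    rintro a b ⟨ha, hb, hab, h⟩
    obtain ⟨h1, h2, h3⟩ := F.dir_sub _ _ h
    exact ⟨⟨ha, h1⟩, ⟨hb, h2⟩, hab, h3⟩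
  bi_sub := by
    rintro a b ⟨ha, hb, hab, h⟩
    obtain ⟨h1, h2, h3⟩ := F.bi_sub _ _ h
    refine ⟨⟨ha, h1⟩, ⟨hb, h2⟩, h3.imp (fun h => ⟨hab, h⟩) fun h => ⟨hab, ?_⟩⟩
    have h4 := scc_eq_scc_iff.1 h.2
    have h5 := reflTransGen_expand hrep h4.1
    have h6 := reflTransGen_expand hrep h4.2
    rw [ha, hb] at h5 h6
    exact scc_eq_scc_iff.2 ⟨h5, h6⟩

theorem Sub.IsCForest.lift (hrep : ∀ c, cl (rep c) = c) {F : G.scProjection.Sub}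
    (hF : F.IsCForest) : (F.lift hrep).IsCForest := by
  refine ⟨fun a ha => hF.1 (cl a) (ha.lift cl fun _ _ h => h.2.2.2), ?_, ?_⟩
  · rintro a b c ⟨-, hb, -, h⟩ ⟨-, hc, -, h'⟩
    rw [← hb, ← hc, hF.2.1 _ _ _ h h']
  · rintro a ⟨ha, ha'⟩ b ⟨hb, hb'⟩
    have h : ReflTransGen (F.lift hrep).bi (rep (cl a)) (rep (cl b)) :=
      (hF.2.2 _ ha' _ hb').map_of_ne rep fun c d hcd h =>
        ⟨by rw [hrep], by rw [hrep], rep_ne hrep hcd, by rwa [hrep, hrep]⟩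
    rwa [ha, hb] at h

theorem Sub.roots_lift (hrep : ∀ c, cl (rep c) = c) {F : G.scProjection.Sub}
    (hF : F.IsCForest) : (F.lift hrep).roots = {a | rep (cl a) = a ∧ cl a ∈ F.roots} := by
  ext a
  constructor
  · rintro ⟨⟨ha, ha'⟩, h⟩
    refine ⟨ha, ha', fun c hc => h (rep c) ⟨ha, by rw [hrep], ?_, by rwa [hrep]⟩⟩
    rintro rfl
    rw [hrep] at hc
    exact hF.1 c (.single hc)
  · rintro ⟨ha, ha', h⟩
    exact ⟨⟨ha, ha'⟩, fun b hb => h _ hb.2.2.2⟩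

/-- One representative per cluster suffices: paths of clusters lift once their self-loops are
skipped, so strongly connected components and ancestors of `Y` survive. -/
theorem HasSCHedge.expand (hrep : ∀ c, cl (rep c) = c) {X Y : Set C} (h : G.HasSCHedge X Y) :
    (G.expand cl).HasSCHedge (cl ⁻¹' X) (cl ⁻¹' Y) := by
  obtain ⟨F, F', hF, hF', R, hR, hR', ⟨x, hxX, hxF⟩, hX', ⟨h1, h2, h3⟩, hRY⟩ := h
  refine ⟨F.lift hrep, F'.lift hrep, hF.lift hrep, hF'.lift hrep, _, Sub.roots_lift hrep hF, ?_,
    ⟨rep x, ?_, ?_⟩, ?_, ⟨?_, ?_, ?_⟩, ?_⟩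
  · rw [Sub.roots_lift hrep hF', hR, hR']
  · rwa [Set.mem_preimage, hrep]
  · exact ⟨by rw [hrep], by rwa [hrep]⟩
  · rw [Set.eq_empty_iff_forall_notMem] at hX' ⊢
    exact fun a ha => hX' (cl a) ⟨ha.1, ha.2.2⟩
  · exact fun a ha => ⟨ha.1, h1 ha.2⟩
  · exact fun a b h => ⟨h.1, h.2.1, h.2.2.1, h2 _ _ h.2.2.2⟩
  · exact fun a b h => ⟨h.1, h.2.1, h.2.2.1, h3 _ _ h.2.2.2⟩
  · rintro a ⟨ha, ha'⟩
    have := rep_mem_ancestors hrep (hRY (hR ▸ ha'))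
    rw [ha] at this
    exact this

end lift

/-! ### Closed walks for the rings and successors for the transport -/

/-- Two distinct vertices with the same strongly connected component lie on a closed walk. -/
theorem exists_closed_walk {a b : N} (hab : a ≠ b) (h1 : ReflTransGen G.dir a b)
    (h2 : ReflTransGen G.dir b a) : ∃ (L : ℕ) (p : Fin (L + 1) → N),
      (∀ i, G.dir (p (i - 1)) (p i)) ∧ (∃ i, p i = a) ∧ ∃ i, p i = b := by
  have hwalk : ∀ {c d}, ReflTransGen G.dir c d →
      ∃ (n : ℕ) (q : ℕ → N), q 0 = c ∧ q n = d ∧ ∀ i < n, G.dir (q i) (q (i + 1)) := by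
    intro c d h
    induction h using ReflTransGen.head_induction_on with
    | refl => exact ⟨0, fun _ => d, rfl, rfl, fun _ h => (Nat.not_lt_zero _ h).elim⟩
    | @head c c' h _ ih =>
      obtain ⟨n, q, h0, hn, hq⟩ := ih
      refine ⟨n + 1, fun i => i.casesOn c q, rfl, hn, fun i hi => ?_⟩
      cases i with
      | zero =>
        change G.dir c (q 0)
        rwa [h0]
      | succ i => exact hq i (by omega)
  obtain ⟨n, q, hq0, hqn, hq⟩ := hwalk h1
  obtain ⟨m, s, hs0, hsm, hs⟩ := hwalk h2
  have hn : n ≠ 0 := by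
    rintro rfl
    exact hab (hq0.symm.trans hqn)
  have hm : m ≠ 0 := by
    rintro rfl
    exact hab (hsm.symm.trans hs0)
  let t : ℕ → N := fun i => if i ≤ n then q i else s (i - n)
  have ht : ∀ i < n + m, G.dir (t i) (t (i + 1)) := by
    intro i hi
    simp only [t]
    by_cases h1 : i + 1 ≤ n
    · rw [if_pos h1, if_pos (by omega)]
      exact hq i (by omega)
    · by_cases h2 : i ≤ n
      · obtain rfl : i = n := by omega
        rw [if_pos le_rfl, if_neg h1, hqn, ← hs0, Nat.add_sub_cancel_left]
        exact hs 0 (by omega)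
      · rw [if_neg h2, if_neg h1, show i + 1 - n = i - n + 1 by omega]
        exact hs _ (by omega)
  have ht0 : t 0 = a := by simp [t, hq0]
  have htn : t n = b := by simp [t, hqn]
  have htm : t (n + m) = a := by
    simp only [t]
    rw [if_neg (by omega), Nat.add_sub_cancel_left, hsm]
  -- The concatenated walk has `n + m` steps and ends where it began; dropping the repeated end
  -- leaves `n + m` cyclic positions, with predecessor `i - 1` in `Fin`.
  refine ⟨n + m - 1, fun i => t i, fun i => ?_, ⟨0, ht0⟩, ⟨⟨n, by omega⟩, htn⟩⟩
  simp only [Fin.coe_sub_one]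
  have hi := i.2
  split_ifs with h
  · subst h
    have := ht (n + m - 1) (by omega)
    rw [show n + m - 1 + 1 = n + m by omega, htm] at this
    exact ht0.symm ▸ this
  · have h0 : (i : ℕ) ≠ 0 := fun h0 => h (Fin.ext h0)
    have := ht (i - 1) (by omega)
    rwa [show (i : ℕ) - 1 + 1 = i by omega] at this

theorem reflTransGen_of_closed_walk {L : ℕ} {p : Fin (L + 1) → N}
    (hp : ∀ i, G.dir (p (i - 1)) (p i)) (i j : Fin (L + 1)) : ReflTransGen G.dir (p i) (p j) := by
  obtain ⟨k, hk⟩ : ∃ k : ℕ, (j - i).val = k := ⟨_, rfl⟩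
  induction k generalizing j with
  | zero =>
    obtain rfl : j = i := sub_eq_zero.1 (Fin.ext hk)
    exact .refl
  | succ k ih =>
    refine (ih (j - 1) ?_).tail (hp j)
    rw [sub_right_comm, Fin.coe_sub_one, if_neg, hk, Nat.add_sub_cancel]
    intro h
    simp [h] at hk

/-- Every vertex with a path to `Y` can choose a successor that is nearer to `Y`. -/
theorem exists_next (G : MixedGraph N) (Y : Set N) : ∃ (next : N → N) (dist : N → ℕ),
    ∀ a ∈ G.ancestors Y, a ∉ Y →
      G.dir a (next a) ∧ next a ∈ G.ancestors Y ∧ dist (next a) < dist a := by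
  classical
  let W : ℕ → N → Prop := Nat.rec (motive := fun _ => N → Prop) (· ∈ Y)
    fun _ P a => ∃ b, G.dir a b ∧ P b
  have hW : ∀ a, a ∈ G.ancestors Y ↔ ∃ n, W n a := by
    intro a
    constructor
    · rintro ⟨y, hy, h⟩
      induction h using ReflTransGen.head_induction_on with
      | refl => exact ⟨0, hy⟩
      | head h _ ih => exact ih.imp' Nat.succ fun n hn => ⟨_, h, hn⟩
    · rintro ⟨n, hn⟩
      induction n generalizing a with
      | zero => exact ⟨a, hn, .refl⟩
      | succ n ih =>
        obtain ⟨b, hab, hb⟩ := hn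
        exact (ih b hb).imp fun y hy => ⟨hy.1, hy.2.head hab⟩
  let dist : N → ℕ := fun a => if h : ∃ n, W n a then Nat.find h else 0
  have hnext : ∀ a, ∃ b, a ∈ G.ancestors Y → a ∉ Y →
      G.dir a b ∧ b ∈ G.ancestors Y ∧ dist b < dist a := by
    intro a
    by_cases ha : ∃ n, W n a
    · have hs := Nat.find_spec ha
      cases hm : Nat.find ha with
      | zero =>
        rw [hm] at hs
        exact ⟨a, fun _ h => (h hs).elim⟩
      | succ m =>
        rw [hm] at hs
        obtain ⟨b, hab, hb⟩ := hs
        refine ⟨b, fun _ _ => ⟨hab, (hW b).2 ⟨m, hb⟩, ?_⟩⟩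
        have hb' : ∃ n, W n b := ⟨m, hb⟩
        simp only [dist, dif_pos ha, dif_pos hb', hm]
        exact Nat.lt_succ_of_le (Nat.find_min' hb' hb)
    · exact ⟨a, fun h => (ha ((hW a).1 h)).elim⟩
  choose next h using hnext
  exact ⟨next, dist, h⟩

end MixedGraph

/-! ### The frame and the wirings of a hedge -/

namespace MixedGraph

variable {N : Type} {V : Type u} (D : MixedGraph N)

/-- The edges between distinct vertices that a C-forest of the SC-projection can use. -/
abbrev ForestEdge : Type := {p : N × N // p.1 ≠ p.2 ∧ D.scProjection.bi p.1 p.2}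

/-- The edges that are added by the SC-projection. -/
abbrev RingEdge : Type := {e : D.ForestEdge // ¬ D.bi e.1.1 e.1.2}

variable {D}

theorem RingEdge.exists_closed_walk (e : D.RingEdge) :
    ∃ w : Σ L : ℕ, Fin (L + 1) → N, (∀ i, D.dir (w.2 (i - 1)) (w.2 i)) ∧
      (∃ i, w.2 i = e.1.1.1) ∧ ∃ i, w.2 i = e.1.1.2 := by
  have h := scc_eq_scc_iff.1 (e.1.2.2.resolve_left e.2).2
  obtain ⟨L, p, hp⟩ := MixedGraph.exists_closed_walk e.1.2.1 h.1 h.2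
  exact ⟨⟨L, p⟩, hp⟩

/-- The length of the ring of an edge, minus one. -/
noncomputable def RingEdge.len (e : D.RingEdge) : ℕ := e.exists_closed_walk.choose.1

/-- The ring of an edge. -/
noncomputable def RingEdge.walk (e : D.RingEdge) : Fin (e.len + 1) → N :=
  e.exists_closed_walk.choose.2

theorem RingEdge.dir_walk (e : D.RingEdge) (i : Fin (e.len + 1)) :
    D.dir (e.walk (i - 1)) (e.walk i) :=
  e.exists_closed_walk.choose_spec.1 i

theorem RingEdge.exists_walk_src (e : D.RingEdge) : ∃ i, e.walk i = e.1.1.1 :=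
  e.exists_closed_walk.choose_spec.2.1

theorem RingEdge.exists_walk_tgt (e : D.RingEdge) : ∃ i, e.walk i = e.1.1.2 :=
  e.exists_closed_walk.choose_spec.2.2

/-- The edges between the latent and the other variables: each variable has a private latent
parent, and the ends of a bidirected edge have a common latent parent. -/
def latentEdge (D : MixedGraph N) (ι : N ≃ V) : N ⊕ N × N → V → Prop
  | .inl a, v => v = ι a
  | .inr p, v => D.bi p.1 p.2 ∧ (v = ι p.1 ∨ v = ι p.2)

/-- The parents of the transport coordinates: the value at a root is copied, and then passed on by
`next` until it reaches `Y`. -/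
def transport (R S Y : Set N) (next : N → N) : N ⊕ N → N ⊕ N → Prop
  | .inl a, .inr b => a ∈ R ∧ a = b
  | .inr a, .inr b => a ∈ S ∧ a ∉ Y ∧ next a = b
  | _, .inl _ => False

theorem iterate_prev {α : Type*} {L : α → ℕ} {e : α} (i j : Fin (L e + 1)) :
    ∃ k, (fun x : Σ e, Fin (L e + 1) => (⟨x.1, x.2 - 1⟩ : Σ e, Fin (L e + 1)))^[k] ⟨e, i⟩ =
      ⟨e, j⟩ := by
  obtain ⟨k, hk⟩ : ∃ k : ℕ, (i - j).val = k := ⟨_, rfl⟩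
  refine ⟨k, ?_⟩
  induction k generalizing i with
  | zero =>
    obtain rfl : i = j := sub_eq_zero.1 (Fin.ext hk)
    rfl
  | succ k ih =>
    rw [Function.iterate_succ_apply]
    refine ih (i - 1) ?_
    rw [sub_right_comm, Fin.coe_sub_one, if_neg, hk, Nat.add_sub_cancel]
    intro h
    simp [h] at hk

open scoped Classical in
/-- The common data of the models of a hedge with roots `R`; here `S` is the set of ancestors of
`Y` outside of `X`. -/
noncomputable def hedgeFrame [Fintype N] (hdir : ∀ a, ¬ D.dir a a) (ι : N ≃ V) (R S Y : Set N)
    (next : N → N) (r : N) : Frame V where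
  dir v w := D.dir (ι.symm v) (ι.symm w)
  dir_irrefl v := hdir _
  Lat := N ⊕ N × N
  lat := D.latentEdge ι
  own v := .inl (ι.symm v)
  lat_own v := (ι.apply_symm_apply v).symm
  I := Σ e : D.RingEdge, Fin (e.len + 1)
  E := D.ForestEdge
  K := N ⊕ N
  loc x := ι (x.1.walk x.2)
  prev x := ⟨x.1, x.2 - 1⟩
  lab x := x.1.1
  lab_prev _ := rfl
  dir_prev x := by simpa using x.1.dir_walk x.2
  exists_iterate_prev := by
    rintro ⟨e, i⟩ ⟨e', j⟩ h
    obtain rfl : e = e' := Subtype.ext h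
    exact iterate_prev i j
  owner := Sum.elim ι ι
  src e := .inl e.1.1
  tgt e := .inl e.1.2
  -- A genuine bidirected edge has one common coin; an added edge uses the private latent variables
  -- of its ends, so that no new bidirected edge appears in the induced DMG.
  srcLat e := if D.bi e.1.1 e.1.2 then .inr e.1 else .inl e.1.1
  tgtLat e := if D.bi e.1.1 e.1.2 then .inr e.1 else .inl e.1.2
  lat_srcLat e := by
    split_ifs with h
    · exact ⟨h, .inl rfl⟩
    · rfl
  lat_tgtLat e := by
    split_ifs with h
    · exact ⟨h, .inr rfl⟩
    · rfl
  pos e := if h : D.bi e.1.1 e.1.2 then none else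
    some ⟨⟨e, h⟩, (RingEdge.exists_walk_tgt ⟨e, h⟩).choose⟩
  loc_pos e x hx := by
    split_ifs at hx with h
    obtain rfl := Option.some_injective _ hx
    exact congrArg ι (RingEdge.exists_walk_tgt ⟨e, h⟩).choose_spec
  lab_pos e x hx := by
    split_ifs at hx with h
    obtain rfl := Option.some_injective _ hx
    rfl
  lat_ne e x hx := by
    split_ifs at hx with h
    rw [if_neg h, if_neg h]
    exact fun h => e.2.1 (Sum.inl_injective h)
  lat_eq e he := by
    split_ifs at he with h
    rw [if_pos h, if_pos h]
  exists_srcLat x := by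
    obtain ⟨i, hi⟩ := x.1.exists_walk_src
    refine ⟨⟨x.1, i⟩, rfl, ?_⟩
    rw [if_neg x.1.2]
    exact congrArg ι hi
  exists_tgtLat x := by
    obtain ⟨i, hi⟩ := x.1.exists_walk_tgt
    refine ⟨⟨x.1, i⟩, rfl, ?_⟩
    rw [if_neg x.1.2]
    exact congrArg ι hi
  -- The second copy `inr` of each vertex is its transport bit. It depends on the forest only
  -- through `R`, so both wirings share the same transport.
  Tr := Sum.inr '' S
  trPar := transport R S Y next
  base := .inl r
  base_notMem := by simp
  root := Sum.inr '' Y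

/-- The forest of a C-forest, extended by the transport coordinates. -/
def forestPar (Φ : D.scProjection.Sub) (S Y : Set N) (next : N → N) : N ⊕ N → N ⊕ N → Prop
  | .inl a, .inl b => Φ.dir a b
  | a, b => transport Φ.roots S Y next a b

/-- The wiring of a C-forest with the given roots. -/
def hedgeWiring [Fintype N] (hdir : ∀ a, ¬ D.dir a a) (ι : N ≃ V) {R S Y : Set N} {next : N → N}
    {dist : N → ℕ} {r : N} (hr : r ∈ R) (hRS : R ⊆ S) (hYS : Y ⊆ S)
    (hnext : ∀ a ∈ S, a ∉ Y → D.dir a (next a) ∧ next a ∈ S ∧ dist (next a) < dist a)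
    (Φ : D.scProjection.Sub) (hΦ : Φ.IsCForest) (hR : Φ.roots = R) :
    Wiring (hedgeFrame hdir ι R S Y next r) where
  H := Sum.elim Φ.verts S
  par := forestPar Φ S Y next
  act := {e | Φ.bi e.1.1 e.1.2}
  par_dir := by
    rintro (a | a) (b | b) h
    · left
      simpa [hedgeFrame, scProjection] using (Φ.dir_sub a b h).2.2
    · right
      exact congrArg ι h.2
    · exact h.elim
    · left
      obtain ⟨ha, haY, rfl⟩ := h
      simpa [hedgeFrame] using (hnext a ha haY).1
  par_wf := by
    have h1 : WellFounded Φ.dir := Finite.wellFounded_of_transGen_irrefl hΦ.1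
    have h2 : WellFounded fun a b => dist b < dist a := by
      have : IsTrans N fun a b => dist b < dist a := ⟨fun _ _ _ h h' => h'.trans h⟩
      have : Std.Irrefl fun a b => dist b < dist a := ⟨fun _ => lt_irrefl _⟩
      exact Finite.wellFounded_of_trans_of_irrefl _
    -- All forest bits come before all transport bits; the latter are ordered by decreasing distance
    -- to `Y`.
    refine Subrelation.wf ?_ (Sum.lex_wf h1 h2)
    rintro (a | a) (b | b) h
    · exact .inl h
    · exact .sep _ _
    · exact h.elim
    · obtain ⟨ha, haY, rfl⟩ := h
      exact .inr (hnext a ha haY).2.2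
  par_mem := by
    rintro (a | a) (b | b) h
    · exact ⟨(Φ.dir_sub a b h).1, (Φ.dir_sub a b h).2.1⟩
    · obtain ⟨ha, rfl⟩ := h
      exact ⟨ha.1, hRS (hR ▸ ha)⟩
    · exact h.elim
    · obtain ⟨ha, haY, rfl⟩ := h
      exact ⟨ha, (hnext a ha haY).2.1⟩
  -- A root of the C-forest has no child there, so its transport copy is its only child.
  par_unique := by
    rintro (a | a) (b | b) (c | c) h h'
    · exact congrArg _ (hΦ.2.1 a b c h h')
    · exact (h'.1.2 b h).elim
    · exact (h.1.2 c h').elim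
    · exact congrArg _ (h.2.symm.trans h'.2)
    all_goals first | exact h.elim | exact h'.elim | skip
    exact congrArg _ (h.2.2.symm.trans h'.2.2)
  act_mem e he := ⟨(Φ.bi_sub _ _ he).1, (Φ.bi_sub _ _ he).2.1⟩
  act_notMem e _ := ⟨fun ⟨_, _, h⟩ => Sum.inr_ne_inl h, fun ⟨_, _, h⟩ => Sum.inr_ne_inl h⟩
  tr_subset := by
    rintro _ ⟨a, ha, rfl⟩
    exact ha
  base_mem := (hR ▸ hr : r ∈ Φ.roots).1
  par_tr := by
    subst hR
    rintro (a | a) _ ⟨b, hb, rfl⟩ <;> rfl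
  mem_root := by
    rintro (a | a)
    · refine ⟨fun ⟨_, _, h⟩ => (Sum.inr_ne_inl h).elim, fun ⟨ha, h⟩ => ?_⟩
      have : a ∈ Φ.roots := ⟨ha, fun b hb => h (.inl b) hb⟩
      exact (h (.inr a) ⟨this, rfl⟩).elim
    · constructor
      · rintro ⟨b, hb, hba⟩
        obtain rfl := Sum.inr_injective hba
        refine ⟨hYS hb, ?_⟩
        rintro (c | c) h
        · exact h
        · exact h.2.1 hb
      · rintro ⟨ha, h⟩
        by_contra haY
        exact h (.inr (next a)) ⟨ha, fun h => haY ⟨a, h, rfl⟩, rfl⟩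
  connected := by
    rintro (a | a) ha ha' (b | b) hb hb'
    · refine (hΦ.2.2 a ha b hb).map_of_ne Sum.inl fun p q hpq h => ?_
      exact ⟨⟨(p, q), hpq, (Φ.bi_sub p q h).2.2⟩, h, .inl ⟨rfl, rfl⟩⟩
    · exact (hb' ⟨b, hb, rfl⟩).elim
    · exact (ha' ⟨a, ha, rfl⟩).elim
    · exact (ha' ⟨a, ha, rfl⟩).elim

end MixedGraph

/-! ### Non-identifiability from a hedge -/

namespace MixedGraph

variable {N : Type} [Fintype N] {V : Type u} {D : MixedGraph N}

theorem dmg_hedgeWiring [Finite V] (hdir : ∀ a, ¬ D.dir a a) (hbi : ∀ a, ¬ D.bi a a) (ι : N ≃ V)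
    {R S Y : Set N} {next : N → N} {r : N} (w : Wiring (hedgeFrame hdir ι R S Y next r))
    [∀ v, MeasurableSpace ((hedgeFrame hdir ι R S Y next r).Dom v)]
    [∀ v, DiscreteMeasurableSpace ((hedgeFrame hdir ι R S Y next r).Dom v)] (a b : N) :
    (w.system.toIOSCM.dmg.dir (ι a) (ι b) ↔ D.dir a b) ∧
      (w.system.toIOSCM.dmg.bi (ι a) (ι b) ↔ D.bi a b) := by
  constructor
  · change D.dir (ι.symm (ι a)) (ι.symm (ι b)) ↔ _
    rw [ι.symm_apply_apply, ι.symm_apply_apply]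
  · change (ι a ≠ ι b ∧ ∃ l, D.latentEdge ι l (ι a) ∧ D.latentEdge ι l (ι b)) ↔ _
    constructor
    · rintro ⟨hab, c | ⟨c, d⟩, h1, h2⟩
      · exact (hab (h1.trans h2.symm)).elim
      · obtain ⟨h, h1⟩ := h1
        obtain ⟨-, h2⟩ := h2
        simp only [ι.injective.eq_iff] at h1 h2 hab
        rcases h1 with rfl | rfl <;> rcases h2 with rfl | rfl
        · exact (hab rfl).elim
        · exact h
        · exact D.bi_symm _ _ h
        · exact (hab rfl).elim
    · intro h
      refine ⟨fun e => ?_, .inr (a, b), ⟨h, .inl rfl⟩, ⟨h, .inr rfl⟩⟩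
      obtain rfl := ι.injective e
      exact hbi a h

/-- The two forests of a hedge define models with the same observational distribution and different
causal effects. -/
theorem exists_models_of_hedge [Finite V] (hdir : ∀ a, ¬ D.dir a a) (ι : N ≃ V) {X Y : Set N}
    (hXY : Disjoint X Y) (h : D.HasSCHedge X Y) :
    ∃ (R S : Set N) (next : N → N) (r : N) (w w' : Wiring (hedgeFrame hdir ι R S Y next r)),
      ∀ [∀ v, MeasurableSpace ((hedgeFrame hdir ι R S Y next r).Dom v)]
        [∀ v, DiscreteMeasurableSpace ((hedgeFrame hdir ι R S Y next r).Dom v)],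
        ¬ ∀ x y : ∀ v, (hedgeFrame hdir ι R S Y next r).Dom v,
          w.system.toIOSCM.doProb (ι.symm ⁻¹' X) x {v | ∀ a ∈ ι.symm ⁻¹' Y, v a = y a} =
            w'.system.toIOSCM.doProb (ι.symm ⁻¹' X) x {v | ∀ a ∈ ι.symm ⁻¹' Y, v a = y a} := by
  obtain ⟨F, F', hFF, hsafe⟩ := exists_safe_hedge hXY h
  have hF'S := hFF.verts_subset
  obtain ⟨hF, hF', R, hR, hR', ⟨x, hxX, hxF⟩, hX', -, hRS⟩ := hFF
  obtain ⟨next, dist, hnext⟩ := exists_next (D.deleteVerts X) Y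
  obtain ⟨r, hr, -⟩ := F.exists_root hF.1 hxF
  obtain ⟨S, hS⟩ : ∃ S, S = (D.deleteVerts X).ancestors Y := ⟨_, rfl⟩
  have hSX : ∀ a ∈ S, a ∉ X := fun a ha => notMem_of_mem_ancestors hXY (hS ▸ ha)
  have hYS : Y ⊆ S := fun a ha => hS ▸ ⟨a, ha, .refl⟩
  have hnext' : ∀ a ∈ S, a ∉ Y →
      D.dir a (next a) ∧ next a ∈ S ∧ dist (next a) < dist a := by
    subst hS
    exact fun a ha haY => (hnext a ha haY).imp_left fun h => h.2.2
  have hRS : R ⊆ S := hS ▸ hRS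
  rw [hR] at hr
  have hX'' : ∀ a ∈ F'.verts, a ∉ X := fun a ha haX =>
    Set.eq_empty_iff_forall_notMem.1 hX' a ⟨haX, ha⟩
  refine ⟨R, S, next, r, hedgeWiring hdir ι hr hRS hYS hnext' F hF hR,
    hedgeWiring hdir ι hr hRS hYS hnext' F' hF' hR', ?_⟩
  intro _ _
  refine Wiring.exists_doProb_ne ?_ ⟨.inl x, hxF, ?_, ?_⟩ ?_ ?_ ?_
  · intro k hk
    -- As `r` is a root of the larger forest too, everything below `base` is transport, and
    -- transport stays in `S`, outside `X`.
    have hk' : k = .inl r ∨ ∃ a ∈ S, k = .inr a := by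
      induction hk with
      | refl => exact .inl rfl
      | @tail p q _ hpq ih =>
        rcases ih with rfl | ⟨a, ha, rfl⟩ <;> rcases q with b | b
        · exact ((hR ▸ hr : r ∈ F.roots).2 b hpq).elim
        · exact .inr ⟨b, hRS (hpq.2 ▸ hr), rfl⟩
        · exact hpq.elim
        · exact .inr ⟨b, hpq.2.2 ▸ (hnext' a ha hpq.2.1).2.1, rfl⟩
    rcases hk' with rfl | ⟨a, ha, rfl⟩
    · simpa [hedgeFrame] using hSX r (hRS hr)
    · simpa [hedgeFrame] using hSX a ha
  · exact fun ⟨_, _, h⟩ => Sum.inr_ne_inl h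
  · simpa [hedgeFrame] using hxX
  · rintro (a | a) ha
    · simpa [hedgeFrame] using hX'' a ha
    · simpa [hedgeFrame] using hSX a ha
  · rintro j hj ⟨e, i⟩ rfl
    intro hi
    have hi : e.walk i ∈ X := by simpa [hedgeFrame] using hi
    obtain ⟨i', hi'⟩ := e.exists_walk_src
    -- A ring position in `X` would be strongly connected to an end of an added edge of the smaller
    -- forest, which the choice of the hedge excludes.
    refine hsafe _ _ hj e.2 _ hi ?_ ?_
    · change ReflTransGen D.dir e.1.1.1 _
      rw [← hi']
      exact reflTransGen_of_closed_walk e.dir_walk _ _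
    · change ReflTransGen D.dir _ e.1.1.1
      rw [← hi']
      exact reflTransGen_of_closed_walk e.dir_walk _ _
  · rintro _ ⟨a, ha, rfl⟩
    simpa [hedgeFrame] using ha

variable {C : Type*} {G : MixedGraph C} {cl : V → C}

/-- The given compatible DMG supplies distinct endpoints for every cluster edge, self-loops
included, and the expanded graph contains all these edges. -/
theorem isClusterGraph_hedgeWiring [Finite V] (hG : G.IsCDMG cl) (ι : N ≃ V)
    (hdir : ∀ a, ¬ (G.expand (cl ∘ ι)).dir a a) {R S Y : Set N} {next : N → N} {r : N}
    (w : Wiring (hedgeFrame hdir ι R S Y next r))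
    [∀ v, MeasurableSpace ((hedgeFrame hdir ι R S Y next r).Dom v)]
    [∀ v, DiscreteMeasurableSpace ((hedgeFrame hdir ι R S Y next r).Dom v)] :
    G.IsClusterGraph cl w.system.toIOSCM.dmg := by
  obtain ⟨-, Ω, _, M, hM1, hM2⟩ := hG
  have key := dmg_hedgeWiring hdir (fun a h => h.1 rfl) ι w
  have key' : ∀ a b, (w.system.toIOSCM.dmg.dir a b ↔ a ≠ b ∧ G.dir (cl a) (cl b)) ∧
      (w.system.toIOSCM.dmg.bi a b ↔ a ≠ b ∧ G.bi (cl a) (cl b)) := by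
    intro a b
    have := key (ι.symm a) (ι.symm b)
    simpa [expand] using this
  refine ⟨fun c d => ⟨fun h => ?_, ?_⟩, fun c d => ⟨fun h => ?_, ?_⟩⟩
  · obtain ⟨a, b, rfl, rfl, hab⟩ := (hM1 c d).1 h
    exact ⟨a, b, rfl, rfl, (key' a b).1.2 ⟨fun e => M.dir_irrefl b (e ▸ hab), h⟩⟩
  · rintro ⟨a, b, rfl, rfl, hab⟩
    exact ((key' a b).1.1 hab).2
  · obtain ⟨a, b, rfl, rfl, hab⟩ := (hM2 c d).1 h
    exact ⟨a, b, rfl, rfl, (key' a b).2.2 ⟨hab.1, h⟩⟩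
  · rintro ⟨a, b, rfl, rfl, hab⟩
    exact ((key' a b).2.1 hab).2

end MixedGraph

theorem mainTheorem5 {V C : Type*} [Finite V] (cl : V → C) (G : MixedGraph C)
    (hG : G.IsCDMG cl)
    (hsize : ∀ S : Set C, G.IsCycle S → ∀ c ∈ S, 2 ≤ (cl ⁻¹' {c}).ncard)
    (X Y : Set C) (hXY : Disjoint X Y) (hhedge : G.HasSCHedge X Y) :
    ¬ G.MacroIdentifiable cl X Y := by
  intro hid
  -- The latent variables are built from the vertices and have to form a `Type`, whereas `V` may
  -- live in a higher universe; hence the detour through `Fin n`.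
  obtain ⟨n, ⟨e⟩⟩ := Finite.exists_equiv_fin V
  let ι := e.symm
  have hdir : ∀ a, ¬ (G.expand (cl ∘ ι)).dir a a := fun a h => h.1 rfl
  choose rep hrep using hG.1.comp ι.surjective
  obtain ⟨R, S, next, r, w, w', h⟩ := MixedGraph.exists_models_of_hedge hdir ι
    (hXY.preimage (cl ∘ ι)) (hhedge.expand hrep)
  have hpre : ∀ X : Set C, ι.symm ⁻¹' (cl ∘ ι ⁻¹' X) = cl ⁻¹' X := fun X => by
    ext v
    simp
  rw [hpre, hpre] at h
  let _ : ∀ v, MeasurableSpace ((MixedGraph.hedgeFrame hdir ι R S (cl ∘ ι ⁻¹' Y) next r).Dom v) :=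
    fun _ => ⊤
  have : ∀ v,
      DiscreteMeasurableSpace ((MixedGraph.hedgeFrame hdir ι R S (cl ∘ ι ⁻¹' Y) next r).Dom v) :=
    fun _ => ⟨fun _ => trivial⟩
  exact h (hid _ w.system.toIOSCM w'.system.toIOSCM rfl rfl
    (MixedGraph.isClusterGraph_hedgeWiring hG ι hdir w)
    (MixedGraph.isClusterGraph_hedgeWiring hG ι hdir w') w.prob_pos (w.prob_eq w'))
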